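/- Fix integers $m\ge 2$ and $k\ge 1$. For $l\ge 0$ let $I_l$ be the set of words of length $l$ over $\{1,\dots,m\}$ (with $I_0=\{\emptyset\}$), let $I=\bigcup_{l\ge0} I_l$, and let $I_\infty$ be the space of infinite words. Write $|\mathbf i|$ for the length of $\mathbf i$, $\mathbf i\preceq\mathbf j$ if $\mathbf i$ is an initial segment of $\mathbf j$, $\mathbf i\wedge\mathbf j$ for the longest common initial segment, and $C_{\mathbf v}=\{\mathbf x\in I_\infty:\mathbf v\preceq\mathbf x\}$. Let $T_k$ be the rooted tree with vertex set $\bigcup_{l=0}^k I_l$, root $\emptyset$, and edges joining each $\mathbf i$ with $|\mathbf i|<k$ to its children $\mathbf i1,\dots,\mathbf im$. Let $\{W_{\mathbf i}:\mathbf i\in I\}$ be independent, almost surely strictly positive random variables on a probability space, with $\mathbb E(W_{\mathbf i})=1$ for all $\mathbf i$, and let $\mu$ be a Borel probability measure on $I_\infty$. For $\mathbf v=(v_1,\dots,v_l)\in I$ put $$X_{\mathbf v}=W_{v_1}W_{v_1v_2}\cdots W_{v_1\cdots v_l}\quad (X_\emptyset=1),\qquad Y_{\mathbf v}=X_{\mathbf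 v}\,\mu(C_{\mathbf v}).$$ For $\mathbf i_1,\dots,\mathbf i_n\in I_k$ (repetitions allowed) let $T(\mathbf i_1,\dots,\mathbf i_n)$ be the minimal subtree of $T_k$ with root $\emptyset$ containing $\mathbf i_1,\dots,\mathbf i_n$, and for $\mathbf j\in I_k$ let $\mathbf j\wedge T(\mathbf i_1,\dots,\mathbf i_n)$ be the longest initial segment of $\mathbf j$ lying in $T(\mathbf i_1,\dots,\mathbf i_n)$. Let $$S^+(n)=\{(\mathbf i_1,\dots,\mathbf i_n;\mathbf p):\mathbf i_1,\dots,\mathbf i_n\in I_k,\ \mathbf p\in T(\mathbf i_1,\dots,\mathbf i_n)\},$$ and for $J\in S^+(n)$ let $[J]$ be its class under the equivalence relation for which $(\mathbf i_1,\dots,\mathbf i_n;\mathbf p)$ and $(\mathbf i'_1,\dots,\mathbf i'_n;\mathbf p')$ are equivalent if some automorphism $g$ of the rooted tree $T_k$ satisfies $g(\mathbf i_r)=\mathbf i'_r$ for all $r$ and $g(\mathbf p)=\mathbf p'$. For $J=(\mathbf i_1,\dots,\mathbf i_n;\mathbf p)$ let $L(J)$ be the multiset of levels $|\mathbf w|$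 of the join points $\mathbf w=\mathbf i_r\wedge\mathbf i_s$ $(r\ne s)$, where $\mathbf w$ is counted with multiplicity $a$ if $a+1$ is the largest size of a set of indices $A\subseteq\{1,\dots,n\}$ such that $\mathbf i_r\wedge\mathbf i_s=\mathbf w$ for all distinct $r,s\in A$; and let $l_0(J)=|\mathbf p|$. **Proposition.** Let $q=n+\varepsilon>1$ with $n$ a nonnegative integer (so that in fact $n\ge 1$) and $0\le\varepsilon<1$, and let $J\in S^+(n)$. Then $L(J)$ has exactly $n-1$ elements, counted with multiplicity, and $$\sum_{(\mathbf i_1,\dots,\mathbf i_n;\mathbf p)\in[J]}\mathbb E\Big(Y_{\mathbf i_1}\cdots Y_{\mathbf i_n}\Big(\sum_{\substack{\mathbf j\in I_k\\ \mathbf j\wedge T(\mathbf i_1,\dots,\mathbf i_n)=\mathbf p}}Y_{\mathbf j}\Big)^{\varepsilon}\Big)\le\prod_{l\in L(J)}\Big(\sum_{|\mathbf u|=l}\mathbb E(Y_{\mathbf u}^q)\Big)^{1/(q-1)}\cdot\Big(\sum_{|\mathbf u|=l_0(J)}\mathbb E(Y_{\mathbf u}^q)\Big)^{\varepsilon/(q-1)},$$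 where the product is taken with multiplicity, expectations take values in $[0,\infty]$, and when $\varepsilon=0$ the two factors with exponent $\varepsilon$ and $\varepsilon/(q-1)$ are equal to $1$. -/

import Mathlib

open MeasureTheory ProbabilityTheory

open scoped ENNReal

namespace Cascade

/-- A finite word over the `m` symbols, i.e. a vertex of the infinite `m`-ary rooted tree. The empty
word is the root, `List.length` is the level, and `v <+: w` says that `v` is a curtailment of `w`. -/
abbrev Word (m : ℕ) : Type := List (Fin m)

/-- The words of length exactly `k`. -/
abbrev Level (m k : ℕ) : Type := List.Vector (Fin m) k

/-- The vertices of the finite tree `T_k`: the words of length at most `k`. -/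
abbrev Vertex (m k : ℕ) : Type := {w : Word m // w.length ≤ k}

noncomputable instance (m k : ℕ) : Fintype (Vertex m k) :=
  (List.finite_length_le (Fin m) k).fintype

/-- The root of `T_k`. -/
def root (m k : ℕ) : Vertex m k := ⟨[], Nat.zero_le k⟩

/-- A word of length `k`, as a bottom vertex of `T_k`. -/
def Level.toVertex {m k : ℕ} (i : Level m k) : Vertex m k := ⟨i.toList, le_of_eq i.toList_length⟩

/-- The tree `T_k` as a graph: the edges join each vertex to its children. -/
def treeGraph (m k : ℕ) : SimpleGraph (Vertex m k) :=
  SimpleGraph.fromRel fun u v => ∃ a : Fin m, v.1 = u.1 ++ [a]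

/-- `meet i j` is the maximal common curtailment `i ∧ j`. -/
def meet {m : ℕ} : Word m → Word m → Word m
  | a :: i, b :: j => if a = b then a :: meet i j else []
  | _, _ => []

/-- The vertex set of the minimal subtree, rooted at the empty word, that contains the given
vertices: it is made of the paths from the root to these vertices. -/
def spanTree {m k n : ℕ} (i : Fin n → Level m k) : Set (Word m) :=
  {w | w = [] ∨ ∃ r, w <+: (i r).toList}

open Classical in
/-- `meetTree j i` is `j ∧ T(i_1, …, i_n)`: the curtailment `j|s` for the largest `s` such that `j|s`
belongs to `T(i_1, …, i_n)`. -/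
noncomputable def meetTree {m k n : ℕ} (j : Word m) (i : Fin n → Level m k) : Word m :=
  j.take (Nat.findGreatest (fun s => j.take s ∈ spanTree i) j.length)

/-- The set `S⁺(n)` of all `(i_1, …, i_n; p)`, where `i_1, …, i_n` are words of length `k` and `p` is a
vertex of `T(i_1, …, i_n)`. -/
abbrev MarkedTuple (m k n : ℕ) : Type :=
  {J : (Fin n → Level m k) × Vertex m k // J.2.1 ∈ spanTree J.1}

namespace MarkedTuple

variable {m k n : ℕ}

/-- The `n`-tuple of bottom vertices. -/
def leaves (J : MarkedTuple m k n) : Fin n → Level m k := J.1.1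

/-- The marked vertex. -/
def mark (J : MarkedTuple m k n) : Vertex m k := J.1.2

/-- Equivalence under the automorphisms of the rooted tree `T_k`. -/
def Equivalent (J K : MarkedTuple m k n) : Prop :=
  ∃ g : treeGraph m k ≃g treeGraph m k, g (root m k) = root m k ∧
    (∀ r, g (J.leaves r).toVertex = (K.leaves r).toVertex) ∧ g J.mark = K.mark

open Classical in
/-- The equivalence class `[J]`. -/
noncomputable def orbit (J : MarkedTuple m k n) : Finset (MarkedTuple m k n) :=
  Finset.univ.filter fun K => J.Equivalent K

end MarkedTuple

/-- The multiplicity of `w` as a join point of `(i_1, …, i_n)`: the largest `a` such that there are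
`a + 1` distinct indices whose words have pairwise meet `w`. -/
def joinMultiplicity {m k n : ℕ} (i : Fin n → Level m k) (w : Word m) : ℕ :=
  ((Finset.univ : Finset (Finset (Fin n))).filter fun A =>
    ∀ r ∈ A, ∀ s ∈ A, r ≠ s → meet (i r).toList (i s).toList = w).sup Finset.card - 1

/-- The join set of `(i_1, …, i_n)`: the meets `i_r ∧ i_s` with `r ≠ s`, counted by multiplicity. -/
def joinSet {m k n : ℕ} (i : Fin n → Level m k) : Multiset (Word m) :=
  ∑ w ∈ (Finset.univ : Finset (Fin n)).offDiag.image
      (fun rs => meet (i rs.1).toList (i rs.2).toList),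
    Multiset.replicate (joinMultiplicity i w) w

/-- The join levels of `(i_1, …, i_n)`, repeated according to multiplicity. -/
def joinLevels {m k n : ℕ} (i : Fin n → Level m k) : Multiset ℕ :=
  (joinSet i).map List.length

/-- The cylinder of all infinite words of which `v` is a curtailment. -/
def cylinder {m : ℕ} (v : Word m) : Set (ℕ → Fin m) :=
  {x | ∀ r : Fin v.length, x r = v.get r}

section Random

variable {m : ℕ} {Ω : Type*}

/-- `X_{i_1 … i_k} = W_{i_1} W_{i_1 i_2} ⋯ W_{i_1 … i_k}`. -/
def X (W : Word m → Ω → ℝ) (v : Word m) (ω : Ω) : ℝ :=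
  ∏ r ∈ Finset.range v.length, W (v.take (r + 1)) ω

/-- `Y_v = X_v μ(C_v)`. -/
noncomputable def Y (W : Word m → Ω → ℝ) (μ : Measure (ℕ → Fin m)) (v : Word m) (ω : Ω) : ℝ :=
  X W v ω * μ.real (cylinder v)

/-- The expectation, in `[0, ∞]`, of a nonnegative random variable. -/
noncomputable def expect [MeasurableSpace Ω] (P : Measure Ω) (f : Ω → ℝ) : ℝ≥0∞ :=
  ∫⁻ ω, ENNReal.ofReal (f ω) ∂P

/-- The sum of `E(Y_u ^ q)` over all words `u` of length `l`. -/
noncomputable def levelMoment [MeasurableSpace Ω] (P : Measure Ω) (W : Word m → Ω → ℝ)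
    (μ : Measure (ℕ → Fin m)) (q : ℝ) (l : ℕ) : ℝ≥0∞ :=
  ∑ u : Level m l, expect P fun ω => Y W μ u.toList ω ^ q

end Random

end Cascade

/-!
Conditionally on the weights of the tree spanned by `i_1, …, i_n`, Jensen's inequality replaces the
sum of the masses hanging off the marked vertex `p` by its mean, so that the sum to be bounded
becomes that of `E(Y_{i_1} ⋯ Y_{i_n} Y_p ^ ε)`. That sum is bounded by induction on the height of
the tree, for products of masses with arbitrary additional powers of masses along the branches, as
the powers `Y_p ^ ε` are inherited by subtrees. The words of a class split into blocks according to
the child of the root below which they lie. Distinct blocks use distinct, so independent, weights; a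
block of total degree `t` contributes `E(W ^ t)` for the weight `W` of its child, which
log-convexity of the moments and `E(W) = 1` bound by `E(W ^ q) ^ ((t - 1) / (q - 1))`. In a block
the exponents of the level moments add up to the same `(t - 1) / (q - 1)`, each branching
contributing `1 / (q - 1)`, so Hölder's inequality over the children turns the moments of the
subtrees into the level moments of the whole tree.
-/

namespace Cascade

section Words

variable {m : ℕ} {γ : Type*}

/-- The restriction of a family indexed by words to the subtree rooted at `p`, which is again
indexed by all words. -/
def below (p : Word m) (f : Word m → γ) (u : Word m) : γ := f (p ++ u)

theorem sum_level_succ [AddCommMonoid γ] {l : ℕ} (f : Level m (l + 1) → γ) :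
    ∑ u, f u = ∑ c, ∑ u : Level m l, f (c ::ᵥ u) := by
  let e : Fin m × Level m l ≃ Level m (l + 1) :=
    { toFun := fun x => x.1 ::ᵥ x.2
      invFun := fun u => (u.head, u.tail)
      left_inv := fun x => by simp
      right_inv := fun u => by simp }
  rw [← e.sum_comp, Fintype.sum_prod_type]
  rfl

theorem Level.toList_eq_cons {l : ℕ} (u : Level m (l + 1)) :
    u.toList = u.head :: u.tail.toList := by
  rw [← List.Vector.toList_cons, List.Vector.cons_head_tail]

theorem sum_drop_le {k : ℕ} (p : Word m) {s : Finset (Level m k)}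
    (hs : ∀ j ∈ s, p <+: j.toList) (f : Word m → ℝ≥0∞) :
    ∑ j ∈ s, f (j.toList.drop p.length) ≤ ∑ u : Level m (k - p.length), f u.toList := by
  classical
  have hinj : Set.InjOn (List.Vector.drop p.length) (s : Set (Level m k)) := fun i hi j hj hij => by
    have hdrop := congrArg List.Vector.toList hij
    rw [List.Vector.toList_drop, List.Vector.toList_drop] at hdrop
    apply List.Vector.eq
    rw [← List.prefix_iff_eq_append.1 (hs i hi), ← List.prefix_iff_eq_append.1 (hs j hj), hdrop]
  calc ∑ j ∈ s, f (j.toList.drop p.length)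
      = ∑ u ∈ s.image (List.Vector.drop p.length), f u.toList := by
        rw [Finset.sum_image hinj]
        simp only [List.Vector.toList_drop]
    _ ≤ _ := Finset.sum_le_univ_sum_of_nonneg fun _ => zero_le

end Words

section Independence

variable {m : ℕ} {Ω : Type*} {w : Word m → Ω → ℝ≥0∞} {κ : Word m → ℝ≥0∞}

/-- The σ-algebra generated by the weights at the words of `S`. -/
abbrev weightSigma (w : Word m → Ω → ℝ≥0∞) (S : Set (Word m)) : MeasurableSpace Ω :=
  ⨆ v ∈ S, MeasurableSpace.comap (w v) inferInstance

theorem measurable_weight {S : Set (Word m)} {v : Word m} (hv : v ∈ S) :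
    Measurable[weightSigma w S] (w v) :=
  (comap_measurable (w v)).mono (le_biSup (fun v => MeasurableSpace.comap (w v) inferInstance) hv)
    le_rfl

theorem measurable_below_weight {S : Set (Word m)} {p v : Word m} (hv : p ++ v ∈ S) :
    Measurable[weightSigma w S] (below p w v) :=
  measurable_weight (w := w) hv

variable [MeasurableSpace Ω] {P : Measure Ω}

/-- A multiplicative cascade: independent weights of mean one on the words, together with an
additive mass, `κ v` being the mass of the cylinder of `v`. -/
structure IsCascade (P : Measure Ω) (w : Word m → Ω → ℝ≥0∞) (κ : Word m → ℝ≥0∞) : Prop where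
  measurable : ∀ v, Measurable (w v)
  indep : iIndepFun w P
  mean : ∀ v, ∫⁻ ω, w v ω ∂P = 1
  additive : ∀ v, ∑ c, κ (v ++ [c]) = κ v

namespace IsCascade

protected theorem below (hw : IsCascade P w κ) (p : Word m) :
    IsCascade P (below p w) (below p κ) where
  measurable v := hw.measurable (p ++ v)
  indep := iIndepFun.precomp (g := (p ++ ·)) (List.append_right_injective p) hw.indep
  mean v := hw.mean (p ++ v)
  additive v := by simpa only [Cascade.below, List.append_assoc] using hw.additive (p ++ v)

theorem weightSigma_le (hw : IsCascade P w κ) (S : Set (Word m)) :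
    weightSigma w S ≤ ‹MeasurableSpace Ω› :=
  iSup₂_le fun v _ => (hw.measurable v).comap_le

theorem lintegral_mul (hw : IsCascade P w κ) {S T : Set (Word m)} (hST : Disjoint S T)
    {f g : Ω → ℝ≥0∞} (hf : Measurable[weightSigma w S] f) (hg : Measurable[weightSigma w T] g) :
    ∫⁻ ω, f ω * g ω ∂P = (∫⁻ ω, f ω ∂P) * ∫⁻ ω, g ω ∂P :=
  lintegral_mul_eq_lintegral_mul_lintegral_of_independent_measurableSpace
    (hw.weightSigma_le S) (hw.weightSigma_le T)
    (indep_iSup_of_disjoint (fun v => (hw.measurable v).comap_le) hw.indep hST) hf hg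

theorem lintegral_prod [IsProbabilityMeasure P] (hw : IsCascade P w κ) {β : Type*}
    (s : Finset β) {S : β → Set (Word m)} (hS : Pairwise fun a b => Disjoint (S a) (S b))
    {G : β → Ω → ℝ≥0∞} (hG : ∀ b, Measurable[weightSigma w (S b)] (G b)) :
    ∫⁻ ω, ∏ b ∈ s, G b ω ∂P = ∏ b ∈ s, ∫⁻ ω, G b ω ∂P := by
  classical
  induction s using Finset.induction with
  | empty => simp
  | insert b s hb ih =>
    have hrest : Measurable[weightSigma w (⋃ c ∈ s, S c)] fun ω => ∏ c ∈ s, G c ω :=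
      Finset.measurable_fun_prod s fun c hc =>
        (hG c).mono (biSup_mono fun v hv => Set.mem_biUnion hc hv) le_rfl
    have hdisj : Disjoint (S b) (⋃ c ∈ s, S c) := by
      simp only [Set.disjoint_iUnion_right]
      exact fun c hc => hS fun h => hb (h ▸ hc)
    simp only [Finset.prod_insert hb]
    rw [hw.lintegral_mul hdisj (hG b) hrest, ih]

end IsCascade

end Independence

section Mass

variable {m : ℕ} {Ω : Type*} {w : Word m → Ω → ℝ≥0∞} {κ : Word m → ℝ≥0∞}

/-- The product of the weights along the path from the root to `u`. -/
noncomputable def pathWeight (w : Word m → Ω → ℝ≥0∞) (u : Word m) (ω : Ω) : ℝ≥0∞ :=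
  ∏ s ∈ Finset.range u.length, w (u.take (s + 1)) ω

/-- The random mass that the cascade gives to the word `u`. -/
noncomputable def mass (w : Word m → Ω → ℝ≥0∞) (κ : Word m → ℝ≥0∞) (u : Word m) (ω : Ω) : ℝ≥0∞ :=
  pathWeight w u ω * κ u

theorem pathWeight_append (p u : Word m) (ω : Ω) :
    pathWeight w (p ++ u) ω = pathWeight w p ω * pathWeight (below p w) u ω := by
  simp only [pathWeight, List.length_append, Finset.prod_range_add, below]
  congr 1 <;> refine Finset.prod_congr rfl fun s hs => ?_
  · rw [List.take_append_of_le_length (Finset.mem_range.1 hs)]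
  · rw [add_assoc, List.take_length_add_append]

theorem mass_append (p u : Word m) (ω : Ω) :
    mass w κ (p ++ u) ω = pathWeight w p ω * mass (below p w) (below p κ) u ω := by
  rw [mass, pathWeight_append, mul_assoc]
  rfl

theorem mass_nil (ω : Ω) : mass w κ [] ω = κ [] := by
  simp [mass, pathWeight]

theorem mass_cons (c : Fin m) (u : Word m) (ω : Ω) :
    mass w κ (c :: u) ω = w [c] ω * mass (below [c] w) (below [c] κ) u ω := by
  rw [← List.singleton_append, mass_append]
  simp [pathWeight]

theorem measurable_pathWeight {M : MeasurableSpace Ω} {u : Word m}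
    (h : ∀ v, v <+: u → v ≠ [] → Measurable[M] (w v)) : Measurable[M] (pathWeight w u) := by
  refine Finset.measurable_fun_prod _ fun s hs => h _ (List.take_prefix _ _) ?_
  rw [Finset.mem_range] at hs
  simpa using List.ne_nil_of_length_pos (by omega)

theorem measurable_mass {M : MeasurableSpace Ω} {u : Word m}
    (h : ∀ v, v <+: u → v ≠ [] → Measurable[M] (w v)) : Measurable[M] (mass w κ u) :=
  (measurable_pathWeight h).mul_const _

/-- The sum of the `q`-th moments of the masses of the words of length `l`. -/
noncomputable def moment [MeasurableSpace Ω] (P : Measure Ω) (w : Word m → Ω → ℝ≥0∞)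
    (κ : Word m → ℝ≥0∞) (q : ℝ) (l : ℕ) : ℝ≥0∞ :=
  ∑ u : Level m l, ∫⁻ ω, mass w κ u.toList ω ^ q ∂P

variable [MeasurableSpace Ω] {P : Measure Ω}

theorem moment_zero [IsProbabilityMeasure P] (q : ℝ) : moment P w κ q 0 = κ [] ^ q := by
  simp [moment, mass_nil]

namespace IsCascade

protected theorem measurable_mass (hw : IsCascade P w κ) (u : Word m) : Measurable (mass w κ u) :=
  measurable_mass fun v _ _ => hw.measurable v

theorem moment_succ (hw : IsCascade P w κ) {q : ℝ} (hq : 0 ≤ q) (l : ℕ) :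
    moment P w κ q (l + 1) =
      ∑ c, (∫⁻ ω, w [c] ω ^ q ∂P) * moment P (below [c] w) (below [c] κ) q l := by
  simp only [moment, sum_level_succ, Finset.mul_sum]
  refine Finset.sum_congr rfl fun c _ => Finset.sum_congr rfl fun u _ => ?_
  have hroot : Measurable[weightSigma w {[c]}] fun ω => w [c] ω ^ q :=
    (measurable_weight (Set.mem_singleton _)).pow_const q
  have hmass : Measurable[weightSigma w {[c]}ᶜ]
      fun ω => mass (below [c] w) (below [c] κ) u.toList ω ^ q :=
    (measurable_mass fun v _ hv => measurable_below_weight (by simpa using hv)).pow_const q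
  rw [← hw.lintegral_mul disjoint_compl_right hroot hmass]
  simp only [List.Vector.toList_cons, mass_cons, ENNReal.mul_rpow_of_nonneg _ _ hq]

theorem sum_lintegral_mass [IsProbabilityMeasure P] (hw : IsCascade P w κ) (l : ℕ) :
    ∑ u : Level m l, ∫⁻ ω, mass w κ u.toList ω ∂P = κ [] := by
  suffices h : moment P w κ 1 l = κ [] by simpa only [moment, ENNReal.rpow_one] using h
  induction l generalizing w κ with
  | zero => rw [moment_zero, ENNReal.rpow_one]
  | succ l ih =>
    rw [hw.moment_succ zero_le_one, ← hw.additive]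
    simp only [ih (hw.below _), ENNReal.rpow_one, hw.mean, one_mul, below, List.append_nil,
      List.nil_append]

end IsCascade

end Mass

section OffTree

variable {m k n : ℕ} {Ω : Type*} {w : Word m → Ω → ℝ≥0∞} {κ : Word m → ℝ≥0∞}

theorem meetTree_prefix (j : Word m) (i : Fin n → Level m k) : meetTree j i <+: j :=
  List.take_prefix _ _

theorem spanTree_of_prefix {i : Fin n → Level m k} {u v : Word m} (hu : u ∈ spanTree i)
    (hv : v <+: u) : v ∈ spanTree i := by
  rcases hu with rfl | ⟨r, hr⟩
  · exact Or.inl (List.prefix_nil.1 hv)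
  · exact Or.inr ⟨r, hv.trans hr⟩

theorem length_le_length_meetTree {i : Fin n → Level m k} {j v : Word m} (hv : v <+: j)
    (hvi : v ∈ spanTree i) : v.length ≤ (meetTree j i).length := by
  classical
  rw [meetTree, List.length_take_of_le (Nat.findGreatest_le _)]
  refine Nat.le_findGreatest hv.length_le ?_
  rwa [← List.prefix_iff_eq_take.1 hv]

theorem measurable_mass_below_meetTree {i : Fin n → Level m k} {j p : Word m}
    (hj : meetTree j i = p) : Measurable[weightSigma w (spanTree i)ᶜ]
      (mass (below p w) (below p κ) (j.drop p.length)) := by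
  refine measurable_mass fun v hv hv₀ => measurable_below_weight fun hmem => hv₀ ?_
  have hpv : p ++ v <+: j := by
    have hpj : p <+: j := hj ▸ meetTree_prefix j i
    rw [← List.prefix_iff_eq_append.1 hpj]
    exact (List.prefix_append_right_inj p).2 hv
  have hlen := length_le_length_meetTree hpv hmem
  rw [hj, List.length_append] at hlen
  exact List.eq_nil_of_length_eq_zero (by omega)

variable [MeasurableSpace Ω] {P : Measure Ω} [IsProbabilityMeasure P]

theorem lintegral_rpow_le_rpow_lintegral {f : Ω → ℝ≥0∞} (hf : AEMeasurable f P) {e : ℝ}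
    (he₀ : 0 ≤ e) (he₁ : e ≤ 1) : ∫⁻ ω, f ω ^ e ∂P ≤ (∫⁻ ω, f ω ∂P) ^ e := by
  simpa using ENNReal.lintegral_mul_norm_pow_le hf (g := fun _ => 1) aemeasurable_const he₀
    (sub_nonneg.2 he₁) (by ring)

theorem IsCascade.lintegral_sum_mass_drop_le (hw : IsCascade P w κ) (p : Word m)
    {s : Finset (Level m k)} (hs : ∀ j ∈ s, p <+: j.toList) :
    ∫⁻ ω, ∑ j ∈ s, mass (below p w) (below p κ) (j.toList.drop p.length) ω ∂P ≤ κ p := by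
  have hbelow := hw.below p
  rw [lintegral_finsetSum _ fun j _ => hbelow.measurable_mass _]
  refine (sum_drop_le p hs fun u => ∫⁻ ω, mass (below p w) (below p κ) u ω ∂P).trans ?_
  rw [hbelow.sum_lintegral_mass, below, List.append_nil]

/-- Jensen's inequality, conditionally on the weights of the spanned tree. -/
theorem IsCascade.lintegral_sum_mass_meetTree_le (hw : IsCascade P w κ) {i : Fin n → Level m k}
    {p : Word m} (hp : p ∈ spanTree i) {e : ℝ} (he₀ : 0 ≤ e) (he₁ : e ≤ 1) :
    ∫⁻ ω, (∏ r, mass w κ (i r).toList ω) *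
        (∑ j : Level m k with meetTree j.toList i = p, mass w κ j.toList ω) ^ e ∂P ≤
      ∫⁻ ω, (∏ r, mass w κ (i r).toList ω) * mass w κ p ω ^ e ∂P := by
  let s : Finset (Level m k) := {j | meetTree j.toList i = p}
  have hs : ∀ j ∈ s, p <+: j.toList := fun j hj =>
    (Finset.mem_filter.1 hj).2 ▸ meetTree_prefix j.toList i
  let A : Ω → ℝ≥0∞ := fun ω => (∏ r, mass w κ (i r).toList ω) * pathWeight w p ω ^ e
  let R : Ω → ℝ≥0∞ := fun ω =>
    ∑ j ∈ s, mass (below p w) (below p κ) (j.toList.drop p.length) ω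
  have hA : Measurable[weightSigma w (spanTree i)] A :=
    (Finset.measurable_fun_prod _ fun r _ => measurable_mass fun v hv _ =>
      measurable_weight (Or.inr ⟨r, hv⟩)).mul
    ((measurable_pathWeight fun v hv _ => measurable_weight (spanTree_of_prefix hp hv)).pow_const e)
  have hR : Measurable[weightSigma w (spanTree i)ᶜ] R :=
    Finset.measurable_fun_sum _ fun j hj =>
      measurable_mass_below_meetTree (Finset.mem_filter.1 hj).2
  calc _ = ∫⁻ ω, A ω * R ω ^ e ∂P := by
        refine lintegral_congr fun ω => ?_
        rw [mul_assoc, ← ENNReal.mul_rpow_of_nonneg _ _ he₀, Finset.mul_sum]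
        congr 2
        refine Finset.sum_congr rfl fun j hj => ?_
        rw [← mass_append, List.prefix_iff_eq_append.1 (hs j hj)]
    _ = (∫⁻ ω, A ω ∂P) * ∫⁻ ω, R ω ^ e ∂P :=
        hw.lintegral_mul disjoint_compl_right hA (hR.pow_const e)
    _ ≤ (∫⁻ ω, A ω ∂P) * κ p ^ e := by
        gcongr
        refine (lintegral_rpow_le_rpow_lintegral ?_ he₀ he₁).trans
          (ENNReal.rpow_le_rpow (hw.lintegral_sum_mass_drop_le p hs) he₀)
        exact (hR.mono (hw.weightSigma_le _) le_rfl).aemeasurable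
    _ = _ := by
        rw [← lintegral_mul_const _ (hA.mono (hw.weightSigma_le _) le_rfl)]
        simp only [A, mass, ENNReal.mul_rpow_of_nonneg _ _ he₀, mul_assoc]

end OffTree

section Inequalities

theorem rpow_sum_of_nonneg {ι : Type*} (x : ℝ≥0∞) {s : Finset ι} {p : ι → ℝ}
    (hp : ∀ i ∈ s, 0 ≤ p i) : x ^ ∑ i ∈ s, p i = ∏ i ∈ s, x ^ p i := by
  classical
  induction s using Finset.induction with
  | empty => simp
  | insert i s hi ih =>
    obtain ⟨hpi, hps⟩ := Finset.forall_mem_insert .. |>.1 hp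
    rw [Finset.sum_insert hi, Finset.prod_insert hi,
      ENNReal.rpow_add_of_nonneg _ _ hpi (Finset.sum_nonneg hps), ih hps]

theorem sum_mul_prod_rpow_le {α ι : Type*} [Fintype α] (s : Finset ι) (g : α → ℝ≥0∞)
    (f : ι → α → ℝ≥0∞) {p : ι → ℝ} (hp : ∀ i ∈ s, 0 ≤ p i) (hs : ∑ i ∈ s, p i ≤ 1) :
    ∑ a, g a ^ (1 - ∑ i ∈ s, p i) * ∏ i ∈ s, f i a ^ p i ≤
      (∑ a, g a) ^ (1 - ∑ i ∈ s, p i) * ∏ i ∈ s, (∑ a, f i a) ^ p i := by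
  let _ : MeasurableSpace α := ⊤
  simpa only [lintegral_fintype, Measure.count_singleton, mul_one] using
    ENNReal.lintegral_mul_prod_norm_pow_le (μ := Measure.count) s (g := g) (f := f)
      measurable_from_top.aemeasurable (fun i _ => measurable_from_top.aemeasurable)
      (1 - ∑ i ∈ s, p i) (sub_add_cancel _ _) (sub_nonneg.2 hs) hp

theorem sum_embedding_le_sum {α β : Type*} [Fintype α] [Fintype β] [DecidableEq α]
    (F : (α → β) → ℝ≥0∞) : ∑ f : α ↪ β, F f ≤ ∑ f, F f := by
  classical
  rw [← Finset.sum_image DFunLike.coe_injective.injOn]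
  exact Finset.sum_le_univ_sum_of_nonneg fun _ => zero_le

theorem lintegral_rpow_le_of_mean_one {Ω : Type*} [MeasurableSpace Ω] {P : Measure Ω}
    {f : Ω → ℝ≥0∞} (hf : AEMeasurable f P) (hmean : ∫⁻ ω, f ω ∂P = 1) {t q : ℝ} (hq : 1 < q)
    (ht : 1 ≤ t) (htq : t ≤ q) : ∫⁻ ω, f ω ^ t ∂P ≤ (∫⁻ ω, f ω ^ q ∂P) ^ ((t - 1) / (q - 1)) := by
  have hq' : 0 < q - 1 := sub_pos.2 hq
  set θ := (t - 1) / (q - 1) with hθ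
  have hθ₀ : 0 ≤ θ := div_nonneg (sub_nonneg.2 ht) hq'.le
  have hθ₁ : 0 ≤ 1 - θ := sub_nonneg.2 ((div_le_one hq').2 (by linarith))
  have ht_eq : t = q * θ + (1 - θ) := by rw [hθ]; field_simp; ring
  calc ∫⁻ ω, f ω ^ t ∂P = ∫⁻ ω, (f ω ^ q) ^ θ * f ω ^ (1 - θ) ∂P := by
        refine lintegral_congr fun ω => ?_
        rw [← ENNReal.rpow_mul, ← ENNReal.rpow_add_of_nonneg _ _ (by positivity) hθ₁, ← ht_eq]
    _ ≤ (∫⁻ ω, f ω ^ q ∂P) ^ θ * (∫⁻ ω, f ω ∂P) ^ (1 - θ) :=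
        ENNReal.lintegral_mul_norm_pow_le (hf.pow_const q) hf hθ₀ hθ₁ (add_sub_cancel _ _)
    _ = (∫⁻ ω, f ω ^ q ∂P) ^ θ := by rw [hmean, ENNReal.one_rpow, mul_one]

end Inequalities

section VertexCount

variable {m h : ℕ} {ι : Type*}

/-- The vertex at level `l` of the branch of index `r` in the tree spanned by the words `J`. At
the levels `l > h`, below the words themselves, the branches of distinct indices are kept apart. -/
def branchVertex (J : ι → Level m h) (l : ℕ) (r : ι) : Word m × Option ι :=
  ((J r).toList.take l, if l ≤ h then none else some r)

open Classical in
/-- The number of vertices at level `l` of the tree spanned by the words `J`, with one leaf added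
at level `h + 1` for each index, so that repeated words branch at level `h`. -/
noncomputable def vertexCount [Fintype ι] (J : ι → Level m h) (l : ℕ) : ℕ :=
  (Finset.univ.image (branchVertex J l)).card

variable [Fintype ι]

theorem vertexCount_zero [Nonempty ι] (J : ι → Level m h) : vertexCount J 0 = 1 := by
  classical
  have hroot : branchVertex J 0 = fun _ => ([], none) := by
    funext r
    simp [branchVertex]
  rw [vertexCount, hroot, Finset.image_const Finset.univ_nonempty, Finset.card_singleton]

theorem vertexCount_last (J : ι → Level m h) : vertexCount J (h + 1) = Fintype.card ι := by
  classical
  refine Finset.card_image_of_injective _ fun r s hrs => ?_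
  simpa [branchVertex] using congrArg Prod.snd hrs

theorem vertexCount_le_succ (J : ι → Level m h) (l : ℕ) :
    vertexCount J l ≤ vertexCount J (l + 1) := by
  classical
  let parent : Word m × Option ι → Word m × Option ι :=
    fun x => (x.1.take l, if l ≤ h then none else x.2)
  have hparent : branchVertex J l = parent ∘ branchVertex J (l + 1) := by
    funext r
    have hl : ¬l ≤ h → ¬l + 1 ≤ h := by omega
    by_cases hlh : l ≤ h <;> simp [parent, branchVertex, List.take_take, hlh, hl]
  rw [vertexCount, vertexCount, hparent, ← Finset.image_image]
  exact Finset.card_image_le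

end VertexCount

section Blocks

variable {m h : ℕ} {ι β : Type*}

/-- The words of the block `a ⁻¹' {b}` of indices, without their first letters. -/
def blockTail (J : ι → Level m (h + 1)) (a : ι → β) (b : β) (r : {r // a r = b}) : Level m h :=
  (J r).tail

/-- The powers carried by the branches of the block `a ⁻¹' {b}`, one level further down. -/
def blockPower (α : ι → ℕ → ℝ) (a : ι → β) (b : β) (r : {r // a r = b}) (l : ℕ) : ℝ :=
  α r (l + 1)

theorem vertexCount_succ [Fintype ι] [Fintype β] [DecidableEq β] {J : ι → Level m (h + 1)}
    {a : ι → β} {g : β ↪ Fin m} (hg : ∀ r, (J r).head = g (a r)) (l : ℕ) :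
    vertexCount J (l + 1) = ∑ b, vertexCount (blockTail J a b) l := by
  classical
  let graft : (Σ b : β, Word m × Option {r // a r = b}) → Word m × Option ι :=
    fun x => (g x.1 :: x.2.1, x.2.2.map Subtype.val)
  have hgraft : Function.Injective graft := by
    rintro ⟨b, u, o⟩ ⟨b', u', o'⟩ hx
    simp only [graft, Prod.mk.injEq, List.cons.injEq, EmbeddingLike.apply_eq_iff_eq] at hx
    obtain ⟨⟨rfl, rfl⟩, ho⟩ := hx
    rw [Option.map_injective Subtype.val_injective ho]
  have hbranch : ∀ b (r : {r // a r = b}),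
      branchVertex J (l + 1) r = graft ⟨b, branchVertex (blockTail J a b) l r⟩ := by
    rintro _ ⟨r, rfl⟩
    simp only [branchVertex, graft, blockTail, Level.toList_eq_cons, hg, List.take_succ_cons,
      Nat.add_le_add_iff_right]
    split_ifs <;> rfl
  simp only [vertexCount]
  rw [← Finset.card_sigma, ← Finset.card_image_of_injective _ hgraft]
  congr 1
  ext x
  simp only [Finset.mem_image, Finset.mem_univ, true_and, Finset.mem_sigma]
  constructor
  · rintro ⟨r, rfl⟩
    exact ⟨_, ⟨⟨r, rfl⟩, rfl⟩, (hbranch _ ⟨r, rfl⟩).symm⟩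
  · rintro ⟨⟨b, y⟩, ⟨r, hr⟩, rfl⟩
    exact ⟨r, (hbranch b r).trans (congrArg (fun y => graft ⟨b, y⟩) hr)⟩

end Blocks

section Exponents

variable {m h : ℕ} {ι : Type*} [Fintype ι] {α : ι → ℕ → ℝ} {q : ℝ}

/-- The exponent with which the moment of level `l` enters the bound for the words `J` whose
branches carry the additional powers `α`: each branching at level `l` contributes `1 / (q - 1)`. -/
noncomputable def exponent (J : ι → Level m h) (α : ι → ℕ → ℝ) (q : ℝ) (l : ℕ) : ℝ :=
  (vertexCount J (l + 1) - vertexCount J l + ∑ r, α r l) / (q - 1)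

/-- The total degree in the mass of a product over `ι` of masses with the additional powers `α` at
the levels below `N`. -/
def degree (α : ι → ℕ → ℝ) (N : ℕ) : ℝ := ∑ r, (1 + ∑ l ∈ Finset.range N, α r l)

theorem exponent_nonneg (J : ι → Level m h) (hα : ∀ r l, 0 ≤ α r l) (hq : 1 < q) (l : ℕ) :
    0 ≤ exponent J α q l :=
  div_nonneg (add_nonneg (sub_nonneg.2 (Nat.cast_le.2 (vertexCount_le_succ J l)))
    (Finset.sum_nonneg fun r _ => hα r l)) (sub_pos.2 hq).le

theorem sum_exponent [Nonempty ι] (J : ι → Level m h) (α : ι → ℕ → ℝ) (q : ℝ) :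
    ∑ l ∈ Finset.range (h + 1), exponent J α q l = (degree α (h + 1) - 1) / (q - 1) := by
  simp only [exponent, degree]
  rw [← Finset.sum_div, Finset.sum_add_distrib,
    Finset.sum_range_sub (fun l => (vertexCount J l : ℝ)), vertexCount_last, vertexCount_zero,
    Finset.sum_comm, Finset.sum_add_distrib, Finset.sum_const, Finset.card_univ, nsmul_one]
  push_cast
  ring

theorem one_le_degree [Nonempty ι] (hα : ∀ r l, 0 ≤ α r l) (N : ℕ) : 1 ≤ degree α N := by
  obtain ⟨r⟩ := ‹Nonempty ι›
  have hterm : ∀ s, 1 ≤ 1 + ∑ l ∈ Finset.range N, α s l := fun s =>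
    le_add_of_nonneg_right (Finset.sum_nonneg fun l _ => hα s l)
  exact (hterm r).trans
    (Finset.single_le_sum (fun s _ => zero_le_one.trans (hterm s)) (Finset.mem_univ r))

variable {β : Type*} [Fintype β] {J : ι → Level m (h + 1)} {a : ι → β} {g : β ↪ Fin m}

theorem exponent_zero [Nonempty ι] (hg : ∀ r, (J r).head = g (a r)) (ha : Function.Surjective a)
    (α : ι → ℕ → ℝ) (q : ℝ) :
    exponent J α q 0 = (Fintype.card β - 1 + ∑ r, α r 0) / (q - 1) := by
  classical
  have hblock (b : β) : Nonempty {r // a r = b} := nonempty_subtype.2 (ha b)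
  simp [exponent, vertexCount_succ hg, vertexCount_zero]

variable [DecidableEq β]

theorem degree_succ (α : ι → ℕ → ℝ) (a : ι → β) (N : ℕ) :
    degree α (N + 1) = ∑ r, α r 0 + ∑ b, degree (blockPower α a b) N := by
  simp only [degree, blockPower]
  rw [Fintype.sum_fiberwise a (fun r => 1 + ∑ l ∈ Finset.range N, α r (l + 1)),
    ← Finset.sum_add_distrib]
  refine Finset.sum_congr rfl fun r _ => ?_
  rw [Finset.sum_range_succ']
  ring

theorem exponent_succ (hg : ∀ r, (J r).head = g (a r)) (α : ι → ℕ → ℝ) (q : ℝ) (l : ℕ) :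
    exponent J α q (l + 1) = ∑ b, exponent (blockTail J a b) (blockPower α a b) q l := by
  simp only [exponent, blockPower, vertexCount_succ hg]
  rw [← Finset.sum_div, Finset.sum_add_distrib, Finset.sum_sub_distrib,
    Fintype.sum_fiberwise a fun r => α r (l + 1)]
  push_cast
  rfl

end Exponents

section PatternMoment

variable {m h : ℕ} {ι β Ω : Type*} {w : Word m → Ω → ℝ≥0∞} {κ : Word m → ℝ≥0∞}

/-- The mass of `u` times the `α l`-th powers of the masses of its prefixes, `l` being the length of
the prefix. -/
noncomputable def poweredMass (w : Word m → Ω → ℝ≥0∞) (κ : Word m → ℝ≥0∞) (α : ℕ → ℝ) (u : Word m)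
    (ω : Ω) : ℝ≥0∞ :=
  mass w κ u ω * ∏ l ∈ Finset.range (u.length + 1), mass w κ (u.take l) ω ^ α l

theorem poweredMass_cons {α : ℕ → ℝ} (hα : ∀ l, 0 ≤ α l) (c : Fin m) (u : Word m) (ω : Ω) :
    poweredMass w κ α (c :: u) ω = κ [] ^ α 0 *
      (w [c] ω ^ (1 + ∑ l ∈ Finset.range (u.length + 1), α (l + 1)) *
        poweredMass (below [c] w) (below [c] κ) (fun l => α (l + 1)) u ω) := by
  have hα' : ∀ l ∈ Finset.range (u.length + 1), 0 ≤ α (l + 1) := fun l _ => hα _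
  rw [poweredMass, List.length_cons, Finset.prod_range_succ', List.take_zero, mass_nil, mass_cons,
    ENNReal.rpow_add_of_nonneg _ _ zero_le_one (Finset.sum_nonneg hα'), rpow_sum_of_nonneg _ hα',
    ENNReal.rpow_one, poweredMass]
  simp only [List.take_succ_cons, mass_cons, ENNReal.mul_rpow_of_nonneg _ _ (hα _),
    Finset.prod_mul_distrib]
  ring

theorem measurable_poweredMass {M : MeasurableSpace Ω} {u : Word m} {α : ℕ → ℝ}
    (h : ∀ v, v <+: u → v ≠ [] → Measurable[M] (w v)) : Measurable[M] (poweredMass w κ α u) :=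
  (measurable_mass h).mul (Finset.measurable_fun_prod _ fun l _ =>
    (measurable_mass fun v hv => h v (hv.trans (List.take_prefix l u))).pow_const _)

/-- The words `f (a r) :: K' (a r) r`: the words of the block `a ⁻¹' {b}` are put below the
child `f b` of the root. -/
def assemble (a : ι → β) (f : β → Fin m) (K' : ∀ b, {r // a r = b} → Level m h) (r : ι) :
    Level m (h + 1) :=
  f (a r) ::ᵥ K' (a r) ⟨r, rfl⟩

theorem prod_poweredMass_assemble [Fintype ι] [Fintype β] [DecidableEq β] {α : ι → ℕ → ℝ}
    (hα : ∀ r l, 0 ≤ α r l) (a : ι → β) (f : β → Fin m)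
    (K' : ∀ b, {r // a r = b} → Level m h) (ω : Ω) :
    ∏ r, poweredMass w κ (α r) (assemble a f K' r).toList ω =
      κ [] ^ (∑ r, α r 0) * ∏ b, (w [f b] ω ^ degree (blockPower α a b) (h + 1) *
        ∏ r, poweredMass (below [f b] w) (below [f b] κ) (blockPower α a b r)
          (K' b r).toList ω) := by
  have hterm : ∀ r, 0 ≤ 1 + ∑ l ∈ Finset.range (h + 1), α r (l + 1) := fun r =>
    add_nonneg zero_le_one (Finset.sum_nonneg fun l _ => hα r _)
  have hblock : ∀ b, (w [f b] ω ^ degree (blockPower α a b) (h + 1) *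
        ∏ r, poweredMass (below [f b] w) (below [f b] κ) (blockPower α a b r) (K' b r).toList ω) =
      ∏ r : {r // a r = b}, (w [f (a r)] ω ^ (1 + ∑ l ∈ Finset.range (h + 1), α r (l + 1)) *
        poweredMass (below [f (a r)] w) (below [f (a r)] κ) (fun l => α r (l + 1))
          (K' (a r) ⟨r, rfl⟩).toList ω) := fun b => by
    simp only [degree, blockPower]
    rw [rpow_sum_of_nonneg _ fun (r : {r // a r = b}) _ => hterm r, ← Finset.prod_mul_distrib]
    refine Finset.prod_congr rfl ?_
    rintro ⟨r, rfl⟩ _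
    rfl
  simp only [hblock]
  rw [Fintype.prod_fiberwise a fun r =>
      (w [f (a r)] ω ^ (1 + ∑ l ∈ Finset.range (h + 1), α r (l + 1)) *
        poweredMass (below [f (a r)] w) (below [f (a r)] κ) (fun l => α r (l + 1))
          (K' (a r) ⟨r, rfl⟩).toList ω),
    rpow_sum_of_nonneg _ fun r _ => hα r 0, ← Finset.prod_mul_distrib]
  refine Finset.prod_congr rfl fun r _ => ?_
  rw [assemble, List.Vector.toList_cons, poweredMass_cons (hα r), List.Vector.toList_length]

variable [MeasurableSpace Ω] {P : Measure Ω}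

/-- The expectation of the product of the masses of the words `K`, with the additional powers `α`
of the masses along their branches. -/
noncomputable def patternMoment [Fintype ι] (P : Measure Ω) (w : Word m → Ω → ℝ≥0∞)
    (κ : Word m → ℝ≥0∞) (α : ι → ℕ → ℝ) (K : ι → Level m h) : ℝ≥0∞ :=
  ∫⁻ ω, ∏ r, poweredMass w κ (α r) (K r).toList ω ∂P

theorem IsCascade.lintegral_block [Fintype ι] (hw : IsCascade P w κ) (α : ι → ℕ → ℝ)
    (K : ι → Level m h) (c : Fin m) (t : ℝ) :
    ∫⁻ ω, w [c] ω ^ t *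
        ∏ r, poweredMass (below [c] w) (below [c] κ) (α r) (K r).toList ω ∂P =
      (∫⁻ ω, w [c] ω ^ t ∂P) * patternMoment P (below [c] w) (below [c] κ) α K := by
  have hroot : Measurable[weightSigma w {[c]}] fun ω => w [c] ω ^ t :=
    (measurable_weight (Set.mem_singleton _)).pow_const t
  have hbelow : Measurable[weightSigma w {[c]}ᶜ]
      fun ω => ∏ r, poweredMass (below [c] w) (below [c] κ) (α r) (K r).toList ω :=
    Finset.measurable_fun_prod _ fun r _ => measurable_poweredMass fun v _ hv =>
      measurable_below_weight (by simpa using hv)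
  exact hw.lintegral_mul disjoint_compl_right hroot hbelow

theorem IsCascade.patternMoment_assemble [IsProbabilityMeasure P] [Fintype ι] [Fintype β]
    [DecidableEq β] (hw : IsCascade P w κ) {α : ι → ℕ → ℝ} (hα : ∀ r l, 0 ≤ α r l) (a : ι → β)
    (f : β ↪ Fin m) (K' : ∀ b, {r // a r = b} → Level m h) :
    patternMoment P w κ α (assemble a f K') = κ [] ^ (∑ r, α r 0) *
      ∏ b, ((∫⁻ ω, w [f b] ω ^ degree (blockPower α a b) (h + 1) ∂P) *
        patternMoment P (below [f b] w) (below [f b] κ) (blockPower α a b) (K' b)) := by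
  let G : β → Ω → ℝ≥0∞ := fun b ω => w [f b] ω ^ degree (blockPower α a b) (h + 1) *
    ∏ r, poweredMass (below [f b] w) (below [f b] κ) (blockPower α a b r) (K' b r).toList ω
  have hG : ∀ b, Measurable[weightSigma w {u | u.head? = some (f b)}] (G b) := fun b => by
    have hroot : Measurable[weightSigma w {u | u.head? = some (f b)}] (w [f b]) :=
      measurable_weight (Set.mem_ofPred.2 rfl)
    have hbelow : ∀ v, Measurable[weightSigma w {u | u.head? = some (f b)}] (below [f b] w v) :=
      fun v => measurable_below_weight (Set.mem_ofPred.2 rfl)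
    exact (hroot.pow_const _).mul (Finset.measurable_fun_prod _ fun r _ =>
      measurable_poweredMass fun v _ _ => hbelow v)
  have hdisj : Pairwise fun b b' =>
      Disjoint {u : Word m | u.head? = some (f b)} {u | u.head? = some (f b')} := fun b b' hb =>
    Set.disjoint_left.2 fun u hu hu' => hb (f.injective (Option.some.inj (hu.symm.trans hu')))
  simp only [← hw.lintegral_block]
  rw [patternMoment]
  simp only [prod_poweredMass_assemble hα]
  rw [lintegral_const_mul _ (Finset.measurable_fun_prod _ fun b _ =>
    (hG b).mono (hw.weightSigma_le _) le_rfl), hw.lintegral_prod _ hdisj hG]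

end PatternMoment

section ShapeClass

variable {m h : ℕ} {ι : Type*}

/-- Two tuples have the same shape if the same pairs of their words agree up to each level. -/
def SameShape (J K : ι → Level m h) : Prop :=
  ∀ l r s, (J r).toList.take l = (J s).toList.take l ↔ (K r).toList.take l = (K s).toList.take l

open Classical in
/-- The tuples of the same shape as `J`. -/
noncomputable def shapeClass [Fintype ι] (J : ι → Level m h) : Finset (ι → Level m h) :=
  {K | SameShape J K}

theorem mem_shapeClass [Fintype ι] {J K : ι → Level m h} : K ∈ shapeClass J ↔ SameShape J K := by
  simp [shapeClass]

variable {β : Type*} [Fintype ι] [DecidableEq β] {J K : ι → Level m (h + 1)} {a : ι → β}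
  {g : β ↪ Fin m}

theorem exists_assemble_of_mem_shapeClass (hg : ∀ r, (J r).head = g (a r))
    (ha : Function.Surjective a) (hK : K ∈ shapeClass J) :
    ∃ (f : β ↪ Fin m) (K' : ∀ b, {r // a r = b} → Level m h),
      (∀ b, K' b ∈ shapeClass (blockTail J a b)) ∧ assemble a f K' = K := by
  rw [mem_shapeClass] at hK
  have hhead : ∀ r s, a r = a s ↔ (K r).head = (K s).head := fun r s => by
    simpa [Level.toList_eq_cons, hg] using hK 1 r s
  have hsection := Function.surjInv_eq ha
  refine ⟨⟨fun b => (K (Function.surjInv ha b)).head, fun b b' hb => ?_⟩, blockTail K a,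
    fun b => mem_shapeClass.2 ?_, ?_⟩
  · rw [← hsection b, (hhead _ _).2 hb, hsection]
  · rintro l ⟨r, hr⟩ ⟨s, hs⟩
    have hrs := (hhead r s).1 (hr.trans hs.symm)
    simpa [Level.toList_eq_cons, hg, hr, hs, hrs, blockTail] using hK (l + 1) r s
  · funext r
    change (K (Function.surjInv ha (a r))).head ::ᵥ (K r).tail = K r
    rw [(hhead _ r).1 (hsection (a r)), List.Vector.cons_head_tail]

theorem sum_shapeClass_le [Fintype β] (hg : ∀ r, (J r).head = g (a r)) (ha : Function.Surjective a)
    (Φ : (ι → Level m (h + 1)) → ℝ≥0∞) :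
    ∑ K ∈ shapeClass J, Φ K ≤ ∑ f : β ↪ Fin m,
      ∑ K' ∈ Fintype.piFinset fun b => shapeClass (blockTail J a b), Φ (assemble a f K') := by
  classical
  rw [← Finset.sum_product']
  refine le_trans (Finset.sum_le_sum_of_subset fun K hK => ?_)
    (Finset.sum_image_le_of_nonneg (g := fun x : (β ↪ Fin m) × (∀ b, {r // a r = b} → Level m h) =>
      assemble a x.1 x.2) fun _ _ => zero_le)
  obtain ⟨f, K', hK', rfl⟩ := exists_assemble_of_mem_shapeClass hg ha hK
  exact Finset.mem_image.2 ⟨(f, K'), by simpa using hK', rfl⟩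

end ShapeClass

section MomentBound

variable {m h : ℕ} {Ω : Type*} [MeasurableSpace Ω] {P : Measure Ω} {w : Word m → Ω → ℝ≥0∞}
  {κ : Word m → ℝ≥0∞} {q : ℝ}

/-- The product of the powers `θ l` of the moments of the levels `l < N`, with a power of the total
mass that makes it homogeneous of degree `1 + (q - 1) * ∑ l < N, θ l` in the masses. -/
noncomputable def momentBound (P : Measure Ω) (w : Word m → Ω → ℝ≥0∞) (κ : Word m → ℝ≥0∞) (q : ℝ)
    (θ : ℕ → ℝ) (N : ℕ) : ℝ≥0∞ :=
  κ [] ^ (1 - ∑ l ∈ Finset.range N, θ l) * ∏ l ∈ Finset.range N, moment P w κ q l ^ θ l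

/-- Log-convexity of the moments of the weights, then Hölder's inequality over the children. -/
theorem IsCascade.sum_children_le (hw : IsCascade P w κ) (hq : 1 < q) {t : ℝ} (ht : 1 ≤ t)
    (htq : t ≤ q) {N : ℕ} {θ : ℕ → ℝ} (hθ : ∀ l, 0 ≤ θ l)
    (hθ_sum : ∑ l ∈ Finset.range N, θ l = (t - 1) / (q - 1)) :
    ∑ c, (∫⁻ ω, w [c] ω ^ t ∂P) * momentBound P (below [c] w) (below [c] κ) q θ N ≤
      κ [] ^ (1 - ∑ l ∈ Finset.range N, θ l) *
        ∏ l ∈ Finset.range N, moment P w κ q (l + 1) ^ θ l := by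
  have hθ' : ∀ l ∈ Finset.range N, 0 ≤ θ l := fun l _ => hθ l
  have hθ_le : ∑ l ∈ Finset.range N, θ l ≤ 1 := by
    rw [hθ_sum]
    exact (div_le_one (sub_pos.2 hq)).2 (by linarith)
  calc _ ≤ ∑ c, κ [c] ^ (1 - ∑ l ∈ Finset.range N, θ l) * ∏ l ∈ Finset.range N,
        ((∫⁻ ω, w [c] ω ^ q ∂P) * moment P (below [c] w) (below [c] κ) q l) ^ θ l := by
        refine Finset.sum_le_sum fun c _ => ?_
        have hroot :=
          lintegral_rpow_le_of_mean_one (hw.measurable [c]).aemeasurable (hw.mean [c]) hq ht htq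
        rw [← hθ_sum, rpow_sum_of_nonneg _ hθ'] at hroot
        refine (mul_le_mul_left hroot _).trans_eq ?_
        rw [momentBound, mul_left_comm, ← Finset.prod_mul_distrib]
        simp only [ENNReal.mul_rpow_of_nonneg _ _ (hθ _)]
        rfl
    _ ≤ _ := sum_mul_prod_rpow_le _ _ _ hθ' hθ_le
    _ = _ := by
        simp only [hw.moment_succ (zero_le_one.trans hq.le), ← hw.additive [], List.nil_append]

theorem rpow_mul_prod_eq_momentBound [IsProbabilityMeasure P] {β : Type*} [Fintype β] {A : ℝ}
    (hq : 0 ≤ q) (hA : 0 ≤ A) {N : ℕ} {θ : ℕ → ℝ} (hθ : ∀ l, 0 ≤ θ l)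
    (hθ_sum : ∑ l ∈ Finset.range (N + 1), θ l ≤ 1) {η : β → ℕ → ℝ} (hη : ∀ b l, 0 ≤ η b l)
    (hη_sum : ∀ b, ∑ l ∈ Finset.range N, η b l ≤ 1) (hzero : q * θ 0 = A + Fintype.card β - 1 + θ 0)
    (hsucc : ∀ l, θ (l + 1) = ∑ b, η b l) :
    κ [] ^ A * ∏ b, (κ [] ^ (1 - ∑ l ∈ Finset.range N, η b l) *
        ∏ l ∈ Finset.range N, moment P w κ q (l + 1) ^ η b l) =
      momentBound P w κ q θ (N + 1) := by
  have hmoments : ∏ b, ∏ l ∈ Finset.range N, moment P w κ q (l + 1) ^ η b l =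
      ∏ l ∈ Finset.range N, moment P w κ q (l + 1) ^ θ (l + 1) := by
    rw [Finset.prod_comm]
    exact Finset.prod_congr rfl fun l _ => by rw [hsucc, rpow_sum_of_nonneg _ fun b _ => hη b l]
  have hexp : A + ∑ b, (1 - ∑ l ∈ Finset.range N, η b l) =
      1 - ∑ l ∈ Finset.range (N + 1), θ l + q * θ 0 := by
    rw [hzero, Finset.sum_range_succ', Finset.sum_sub_distrib, Finset.sum_comm]
    simp only [hsucc, Finset.sum_const, Finset.card_univ, nsmul_one]
    ring
  have hrest : ∀ b ∈ Finset.univ, 0 ≤ 1 - ∑ l ∈ Finset.range N, η b l := fun b _ =>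
    sub_nonneg.2 (hη_sum b)
  rw [momentBound, Finset.prod_mul_distrib, hmoments, Finset.prod_range_succ', moment_zero,
    ← rpow_sum_of_nonneg _ hrest, ← ENNReal.rpow_mul, ← mul_assoc,
    ← ENNReal.rpow_add_of_nonneg _ _ hA (Finset.sum_nonneg hrest), hexp,
    ENNReal.rpow_add_of_nonneg _ _ (sub_nonneg.2 hθ_sum) (mul_nonneg hq (hθ 0))]
  ring

end MomentBound

section Induction

variable {m : ℕ} {Ω : Type*} [MeasurableSpace Ω] {P : Measure Ω} [IsProbabilityMeasure P]
  {w : Word m → Ω → ℝ≥0∞} {κ : Word m → ℝ≥0∞} {q : ℝ}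

theorem sum_exponent_le_one {h : ℕ} {ι : Type*} [Fintype ι] [Nonempty ι] (J : ι → Level m h)
    {α : ι → ℕ → ℝ} (hq : 1 < q) (hdeg : degree α (h + 1) ≤ q) :
    ∑ l ∈ Finset.range (h + 1), exponent J α q l ≤ 1 := by
  rw [sum_exponent]
  exact (div_le_one (sub_pos.2 hq)).2 (by linarith)

theorem patternMoment_zero {ι : Type*} [Fintype ι] [Nonempty ι] {α : ι → ℕ → ℝ}
    (hα : ∀ r l, 0 ≤ α r l) (hq : 1 < q) (hdeg : degree α 1 ≤ q) (J : ι → Level m 0) :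
    patternMoment P w κ α J = momentBound P w κ q (exponent J α q) 1 := by
  have hterm : ∀ r, 0 ≤ 1 + α r 0 := fun r => add_nonneg zero_le_one (hα r 0)
  have hθ : exponent J α q 0 = (degree α 1 - 1) / (q - 1) := by simpa using sum_exponent J α q
  have hθ_le : exponent J α q 0 ≤ 1 := by simpa using sum_exponent_le_one J hq hdeg
  have hmass : patternMoment P w κ α J = κ [] ^ degree α 1 := by
    simp [patternMoment, poweredMass, List.Vector.eq_nil, mass_nil, degree, rpow_sum_of_nonneg,
      hterm, ENNReal.rpow_add_of_nonneg, hα]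
  have hdeg_eq : degree α 1 = 1 - exponent J α q 0 + q * exponent J α q 0 := by
    rw [hθ]
    have := sub_pos.2 hq
    field_simp
    ring
  rw [momentBound, Finset.sum_range_one, Finset.prod_range_one, moment_zero, ← ENNReal.rpow_mul,
    ← ENNReal.rpow_add_of_nonneg _ _ (sub_nonneg.2 hθ_le)
      (mul_nonneg (zero_le_one.trans hq.le) (exponent_nonneg J hα hq 0)), ← hdeg_eq, hmass]

theorem IsCascade.sum_patternMoment_le_prod {h : ℕ} {ι β : Type*} [Fintype ι] [Fintype β]
    [DecidableEq β] (hw : IsCascade P w κ) {α : ι → ℕ → ℝ} (hα : ∀ r l, 0 ≤ α r l)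
    {J : ι → Level m (h + 1)} {a : ι → β} {g : β ↪ Fin m} (hg : ∀ r, (J r).head = g (a r))
    (ha : Function.Surjective a) :
    ∑ K ∈ shapeClass J, patternMoment P w κ α K ≤ κ [] ^ (∑ r, α r 0) *
      ∏ b, ∑ c, (∫⁻ ω, w [c] ω ^ degree (blockPower α a b) (h + 1) ∂P) *
        ∑ K ∈ shapeClass (blockTail J a b),
          patternMoment P (below [c] w) (below [c] κ) (blockPower α a b) K := by
  let F : ∀ b, Fin m → ({r // a r = b} → Level m h) → ℝ≥0∞ := fun b c K =>
    (∫⁻ ω, w [c] ω ^ degree (blockPower α a b) (h + 1) ∂P) *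
      patternMoment P (below [c] w) (below [c] κ) (blockPower α a b) K
  calc _ ≤ ∑ f : β ↪ Fin m, ∑ K' ∈ Fintype.piFinset fun b => shapeClass (blockTail J a b),
        patternMoment P w κ α (assemble a f K') := sum_shapeClass_le hg ha _
    _ = κ [] ^ (∑ r, α r 0) *
        ∑ f : β ↪ Fin m, ∏ b, ∑ K ∈ shapeClass (blockTail J a b), F b (f b) K := by
      simp only [hw.patternMoment_assemble hα, Finset.prod_univ_sum, Finset.mul_sum]
      rfl
    _ ≤ κ [] ^ (∑ r, α r 0) *
        ∑ f : β → Fin m, ∏ b, ∑ K ∈ shapeClass (blockTail J a b), F b (f b) K := by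
      gcongr
      exact sum_embedding_le_sum fun f => ∏ b, ∑ K ∈ shapeClass (blockTail J a b), F b (f b) K
    _ = _ := by
      rw [Fintype.prod_sum]
      simp only [Finset.mul_sum]
      rfl

theorem IsCascade.sum_patternMoment_le (hw : IsCascade P w κ) (hq : 1 < q) {h : ℕ} {ι : Type*}
    [Fintype ι] [Nonempty ι] (J : ι → Level m h) {α : ι → ℕ → ℝ} (hα : ∀ r l, 0 ≤ α r l)
    (hdeg : degree α (h + 1) ≤ q) :
    ∑ K ∈ shapeClass J, patternMoment P w κ α K ≤
      momentBound P w κ q (exponent J α q) (h + 1) := by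
  classical
  induction h generalizing ι w κ with
  | zero =>
    refine (Finset.sum_le_univ_sum_of_nonneg fun _ => zero_le).trans_eq ?_
    rw [Fintype.sum_subsingleton _ J, patternMoment_zero hα hq hdeg]
  | succ h ih =>
    let a : ι → Set.range fun r => (J r).head := Set.rangeFactorization _
    have ha : Function.Surjective a := Set.rangeFactorization_surjective
    have hg : ∀ r, (J r).head = Function.Embedding.subtype _ (a r) := fun r => rfl
    have hblock (b) : Nonempty {r // a r = b} := nonempty_subtype.2 (ha b)
    have hα' (b) : ∀ r l, 0 ≤ blockPower α a b r l := fun r l => hα r.1 (l + 1)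
    have hone (b) : 1 ≤ degree (blockPower α a b) (h + 1) := one_le_degree (hα' b) _
    have hA : 0 ≤ ∑ r, α r 0 := Finset.sum_nonneg fun r _ => hα r 0
    have hdeg' (b) : degree (blockPower α a b) (h + 1) ≤ q := by
      have := Finset.single_le_sum (f := fun b => degree (blockPower α a b) (h + 1))
        (fun b _ => zero_le_one.trans (hone b)) (Finset.mem_univ b)
      linarith [degree_succ α a (h + 1)]
    let η := fun b => exponent (blockTail J a b) (blockPower α a b) q
    calc _ ≤ _ := hw.sum_patternMoment_le_prod hα hg ha
      _ ≤ κ [] ^ (∑ r, α r 0) * ∏ b, (κ [] ^ (1 - ∑ l ∈ Finset.range (h + 1), η b l) *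
          ∏ l ∈ Finset.range (h + 1), moment P w κ q (l + 1) ^ η b l) := by
        gcongr with b
        refine (Finset.sum_le_sum fun c _ => ?_).trans
          (hw.sum_children_le hq (hone b) (hdeg' b) (exponent_nonneg _ (hα' b) hq)
            (sum_exponent _ _ q))
        gcongr
        exact ih (hw.below [c]) _ (hα' b) (hdeg' b)
      _ = _ := by
        refine rpow_mul_prod_eq_momentBound (zero_le_one.trans hq.le) hA
          (exponent_nonneg J hα hq) (sum_exponent_le_one J hq hdeg)
          (fun b => exponent_nonneg _ (hα' b) hq)
          (fun b => sum_exponent_le_one _ hq (hdeg' b)) ?_ (exponent_succ hg α q)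
        rw [exponent_zero hg ha]
        have := sub_pos.2 hq
        field_simp
        ring

end Induction

section Meet

variable {m : ℕ}

theorem meet_prefix_left : ∀ i j : Word m, meet i j <+: i
  | [], _ => by simp [meet]
  | a :: i, [] => by simp [meet]
  | a :: i, b :: j => by
    rw [meet]
    split_ifs with hab
    · exact List.cons_prefix_cons.2 ⟨rfl, meet_prefix_left i j⟩
    · exact List.nil_prefix

theorem take_length_meet (i j : Word m) : i.take (meet i j).length = meet i j :=
  (List.prefix_iff_eq_take.1 (meet_prefix_left i j)).symm

theorem take_eq_take_iff_le_length_meet : ∀ {i j : Word m} {l : ℕ}, l ≤ i.length → l ≤ j.length →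
    (i.take l = j.take l ↔ l ≤ (meet i j).length)
  | _, _, 0, _, _ => by simp
  | a :: i, b :: j, l + 1, hi, hj => by
    have ih := take_eq_take_iff_le_length_meet (i := i) (j := j) (l := l)
      (Nat.le_of_succ_le_succ hi) (Nat.le_of_succ_le_succ hj)
    rw [meet]
    split_ifs with hab <;> simp [hab, ih]

end Meet

section ChildCount

variable {m h : ℕ} {ι : Type*} [Fintype ι] (J : ι → Level m h)

open Classical in
/-- The number of children of the vertex `u` in the tree counted by `vertexCount`. -/
noncomputable def childCount (u : Word m) : ℕ :=
  (({r | (J r).toList.take u.length = u} : Finset ι).image (branchVertex J (u.length + 1))).card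

theorem childCount_pos {u : Word m} {r : ι} (hr : (J r).toList.take u.length = u) :
    0 < childCount J u := by
  classical
  exact Finset.card_pos.2 ⟨_, Finset.mem_image_of_mem _ (by simpa using hr)⟩

theorem card_le_childCount {u : Word m} {A : Finset ι}
    (hA : ∀ r ∈ A, (J r).toList.take u.length = u)
    (hinj : Set.InjOn (branchVertex J (u.length + 1)) A) : A.card ≤ childCount J u := by
  classical
  rw [childCount, ← Finset.card_image_of_injOn hinj]
  exact Finset.card_le_card (Finset.image_subset_image fun r hr => by simpa using hA r hr)

theorem exists_card_eq_childCount (u : Word m) : ∃ A : Finset ι,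
    (∀ r ∈ A, (J r).toList.take u.length = u) ∧
      Set.InjOn (branchVertex J (u.length + 1)) A ∧ A.card = childCount J u := by
  classical
  obtain ⟨A, hA, hinj, himage⟩ := Finset.exists_subset_injOn_image_eq_of_surjOn
    (f := branchVertex J (u.length + 1)) {r | (J r).toList.take u.length = u}
    (({r | (J r).toList.take u.length = u} : Finset ι).image (branchVertex J (u.length + 1)))
    (by simpa using Set.surjOn_image _ _)
  exact ⟨A, fun r hr => hA hr, hinj, by rw [childCount, ← himage, Finset.card_image_of_injOn hinj]⟩

theorem vertexCount_eq_card_image_take {l : ℕ} (hl : l ≤ h) :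
    vertexCount J l = (Finset.univ.image fun r => (J r).toList.take l).card := by
  classical
  have hbranch : branchVertex J l =
      (fun u : Word m => (u, (none : Option ι))) ∘ fun r => (J r).toList.take l := by
    funext r
    simp [branchVertex, hl]
  rw [vertexCount, hbranch, ← Finset.image_image]
  exact Finset.card_image_of_injective _ fun u v huv => (Prod.mk.inj huv).1

theorem vertexCount_succ_eq_sum_childCount {l : ℕ} (hl : l ≤ h) :
    vertexCount J (l + 1) =
      ∑ u ∈ Finset.univ.image fun r => (J r).toList.take l, childCount J u := by
  classical
  rw [vertexCount, Finset.card_eq_sum_card_fiberwise (f := fun x => x.1.take l)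
    (t := Finset.univ.image fun r => (J r).toList.take l)]
  · refine Finset.sum_congr rfl fun u hu => ?_
    obtain ⟨r, -, rfl⟩ := Finset.mem_image.1 hu
    have hlen : ((J r).toList.take l).length = l := by simpa using hl
    rw [childCount, hlen, Finset.filter_image]
    simp [branchVertex, List.take_take]
  · intro x hx
    obtain ⟨r, -, rfl⟩ := Finset.mem_image.1 (Finset.mem_coe.1 hx)
    exact Finset.mem_coe.2 (Finset.mem_image.2 ⟨r, Finset.mem_univ r, by
      simp [branchVertex, List.take_take]⟩)

end ChildCount

section Joins

variable {m k n : ℕ} (i : Fin n → Level m k)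

theorem meet_eq_iff {r s : Fin n} (hrs : r ≠ s) {u : Word m} (hu : u.length ≤ k) :
    meet (i r).toList (i s).toList = u ↔ (i r).toList.take u.length = u ∧
      (i s).toList.take u.length = u ∧
      branchVertex i (u.length + 1) r ≠ branchVertex i (u.length + 1) s := by
  have htake : ∀ l ≤ k, ((i r).toList.take l = (i s).toList.take l ↔
      l ≤ (meet (i r).toList (i s).toList).length) := fun l hl =>
    take_eq_take_iff_le_length_meet (by simpa using hl) (by simpa using hl)
  have hle : (meet (i r).toList (i s).toList).length ≤ k := by
    simpa using (meet_prefix_left (i r).toList (i s).toList).length_le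
  have hbranch : branchVertex i (u.length + 1) r = branchVertex i (u.length + 1) s ↔
      u.length < (meet (i r).toList (i s).toList).length := by
    by_cases hu' : u.length + 1 ≤ k
    · simp [branchVertex, hu', htake _ hu']
    · simp only [branchVertex, hu', if_false, Prod.mk.injEq, Option.some.injEq, hrs, and_false,
        false_iff]
      omega
  rw [ne_eq, hbranch, not_lt]
  constructor
  · rintro rfl
    exact ⟨take_length_meet _ _, ((htake _ hu).2 le_rfl).symm.trans (take_length_meet _ _), le_rfl⟩
  · rintro ⟨hr, hs, hlen⟩
    rw [← take_length_meet, hlen.antisymm ((htake _ hu).1 (hr.trans hs.symm)), hr]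

theorem joinMultiplicity_eq_childCount_sub_one {u : Word m} (hu : u.length ≤ k) {r : Fin n}
    (hr : (i r).toList.take u.length = u) : joinMultiplicity i u = childCount i u - 1 := by
  rw [joinMultiplicity]
  congr 1
  apply le_antisymm
  · refine Finset.sup_le fun A hA => ?_
    have hmeet := (Finset.mem_filter.1 hA).2
    rcases Nat.lt_or_ge 1 A.card with hcard | hcard
    · refine card_le_childCount i (fun s hs => ?_) fun s hs t ht hst => ?_
      · obtain ⟨t, ht, hts⟩ := Finset.exists_mem_ne hcard s
        exact ((meet_eq_iff i hts hu).1 (hmeet t ht s hs hts)).2.1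
      · by_contra hne
        exact ((meet_eq_iff i hne hu).1 (hmeet s hs t ht hne)).2.2 hst
    · exact hcard.trans (childCount_pos i hr)
  · obtain ⟨A, hA, hinj, hcard⟩ := exists_card_eq_childCount i u
    rw [← hcard]
    refine Finset.le_sup (f := Finset.card) (Finset.mem_filter.2 ⟨Finset.mem_univ A, ?_⟩)
    exact fun s hs t ht hst => (meet_eq_iff i hst hu).2
      ⟨hA s hs, hA t ht, fun hbranch => hst (hinj hs ht hbranch)⟩

/-- The join points of the words `i`, without multiplicities. -/
def joinPoints : Finset (Word m) :=
  (Finset.univ : Finset (Fin n)).offDiag.image fun rs => meet (i rs.1).toList (i rs.2).toList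

theorem joinMultiplicity_eq_zero {u : Word m} (hu : u ∉ joinPoints i) :
    joinMultiplicity i u = 0 := by
  rw [joinMultiplicity, Nat.sub_eq_zero_iff_le]
  refine Finset.sup_le fun A hA => Finset.card_le_one.2 fun r hr s hs => ?_
  by_contra hrs
  exact hu (Finset.mem_image.2 ⟨(r, s), by simpa using hrs,
    (Finset.mem_filter.1 hA).2 r hr s hs hrs⟩)

theorem sum_joinMultiplicity {l : ℕ} (hl : l ≤ k) :
    ∑ u ∈ joinPoints i with u.length = l, joinMultiplicity i u =
      vertexCount i (l + 1) - vertexCount i l := by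
  have hlen : ∀ r, ((i r).toList.take l).length = l := fun r => by simpa using hl
  calc _ = ∑ u ∈ Finset.univ.image fun r => (i r).toList.take l, joinMultiplicity i u := by
        refine Finset.sum_subset (fun u hu => ?_) fun u hu hu' => joinMultiplicity_eq_zero i
          fun hjoin => ?_
        · obtain ⟨hjoin, rfl⟩ := Finset.mem_filter.1 hu
          obtain ⟨⟨r, s⟩, -, rfl⟩ := Finset.mem_image.1 hjoin
          exact Finset.mem_image.2 ⟨r, Finset.mem_univ r, take_length_meet _ _⟩
        · obtain ⟨r, -, rfl⟩ := Finset.mem_image.1 hu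
          exact hu' (Finset.mem_filter.2 ⟨hjoin, hlen r⟩)
    _ = ∑ u ∈ Finset.univ.image fun r => (i r).toList.take l, (childCount i u - 1) := by
        refine Finset.sum_congr rfl fun u hu => ?_
        obtain ⟨r, -, rfl⟩ := Finset.mem_image.1 hu
        exact joinMultiplicity_eq_childCount_sub_one i ((hlen r).trans_le hl) (r := r)
          (by rw [hlen])
    _ = _ := by
        rw [vertexCount_succ_eq_sum_childCount i hl, vertexCount_eq_card_image_take i hl,
          Finset.card_eq_sum_ones, ← Finset.sum_tsub_distrib]
        intro u hu
        obtain ⟨r, -, rfl⟩ := Finset.mem_image.1 hu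
        exact childCount_pos i (r := r) (by rw [hlen])

theorem joinLevels_eq_sum_replicate : joinLevels i = ∑ l ∈ Finset.range (k + 1),
    Multiset.replicate (vertexCount i (l + 1) - vertexCount i l) l := by
  have hlevel : ∀ u ∈ joinPoints i, u.length ∈ Finset.range (k + 1) := fun u hu => by
    obtain ⟨⟨r, s⟩, -, rfl⟩ := Finset.mem_image.1 hu
    exact Finset.mem_range_succ_iff.2
      ((meet_prefix_left _ _).length_le.trans (i r).toList_length.le)
  calc joinLevels i
      = ∑ u ∈ joinPoints i, Multiset.replicate (joinMultiplicity i u) u.length := by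
        rw [joinLevels, joinSet, ← Multiset.coe_mapAddMonoidHom, map_sum]
        simp only [Multiset.coe_mapAddMonoidHom, Multiset.map_replicate, joinPoints]
    _ = ∑ l ∈ Finset.range (k + 1), ∑ u ∈ joinPoints i with u.length = l,
          Multiset.replicate (joinMultiplicity i u) l := by
        rw [← Finset.sum_fiberwise_of_maps_to hlevel]
        exact Finset.sum_congr rfl fun l _ => Finset.sum_congr rfl fun u hu => by
          rw [(Finset.mem_filter.1 hu).2]
    _ = _ := Finset.sum_congr rfl fun l hl => by
        rw [← sum_joinMultiplicity i (Finset.mem_range_succ_iff.1 hl)]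
        exact (map_sum (Multiset.replicateAddMonoidHom l) _ _).symm

theorem card_joinLevels [NeZero n] : (joinLevels i).card + 1 = n := by
  have hmono : Monotone (vertexCount i) := monotone_nat_of_le_succ (vertexCount_le_succ i)
  rw [joinLevels_eq_sum_replicate, Multiset.card_sum]
  simp only [Multiset.card_replicate]
  rw [Finset.sum_range_tsub hmono, vertexCount_last, vertexCount_zero, Fintype.card_fin]
  exact Nat.sub_add_cancel NeZero.one_le

theorem prod_joinLevels (F : ℕ → ℝ≥0∞) : ((joinLevels i).map F).prod =
    ∏ l ∈ Finset.range (k + 1), F l ^ (vertexCount i (l + 1) - vertexCount i l) := by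
  rw [joinLevels_eq_sum_replicate, ← Multiset.coe_mapAddMonoidHom, map_sum, Multiset.prod_sum]
  simp only [Multiset.coe_mapAddMonoidHom, Multiset.map_replicate, Multiset.prod_replicate]

end Joins

section Automorphisms

variable {m k : ℕ} {g : treeGraph m k ≃g treeGraph m k}

theorem treeGraph_adj {u v : Vertex m k} :
    (treeGraph m k).Adj u v ↔ (∃ a, v.1 = u.1 ++ [a]) ∨ ∃ a, u.1 = v.1 ++ [a] := by
  rw [treeGraph, SimpleGraph.fromRel_adj, and_iff_right_iff_imp]
  rintro h rfl
  simp at h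

theorem automorphism_child (hg : g (root m k) = root m k) {u v : Vertex m k}
    (huv : ∃ a, v.1 = u.1 ++ [a]) : ∃ b, (g v).1 = (g u).1 ++ [b] := by
  rcases treeGraph_adj.1 (g.map_adj_iff.2 (treeGraph_adj.2 (Or.inl huv))) with hdown | ⟨b, hup⟩
  · exact hdown
  -- `g u` would be a child of `g v`; it also is a child of the image of the parent of `u`.
  exfalso
  obtain ⟨a, huv⟩ := huv
  rcases List.eq_nil_or_concat' u.1 with hu | ⟨t, c, hu⟩
  · have hroot : g u = root m k := (congrArg g (Subtype.ext hu)).trans hg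
    simp [hroot, root] at hup
  · have hlen : t.length < u.1.length := by simp [hu]
    have ht : t.length ≤ k := hlen.le.trans u.2
    obtain ⟨d, hd⟩ := automorphism_child hg (u := ⟨t, ht⟩) ⟨c, hu⟩
    have htv := g.injective (Subtype.ext (List.append_inj_left' (hd.symm.trans hup) rfl))
    have := congrArg (fun x => x.1.length) htv
    simp only [huv, hu, List.length_append, List.length_singleton] at this
    omega
termination_by u.1.length

theorem automorphism_length (hg : g (root m k) = root m k) (v : Vertex m k) :
    (g v).1.length = v.1.length := by
  obtain ⟨v, hv⟩ := v
  induction v using List.reverseRecOn with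
  | nil => exact congrArg (fun x => x.1.length) hg
  | append_singleton u c ih =>
    have hu : u.length ≤ k := (List.prefix_append u [c]).length_le.trans hv
    obtain ⟨d, hd⟩ := automorphism_child hg (u := ⟨u, hu⟩) (v := ⟨u ++ [c], hv⟩) ⟨c, rfl⟩
    simp [hd, ih hu]

theorem automorphism_prefix (hg : g (root m k) = root m k) {u v : Vertex m k}
    (huv : u.1 <+: v.1) : (g u).1 <+: (g v).1 := by
  obtain ⟨v, hv⟩ := v
  induction v using List.reverseRecOn with
  | nil => rw [show u = ⟨[], hv⟩ from Subtype.ext (List.prefix_nil.1 huv)]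
  | append_singleton v c ih =>
    rcases List.prefix_concat_iff.1 huv with heq | hprefix
    · rw [show u = ⟨v ++ [c], hv⟩ from Subtype.ext heq]
    · have hv' : v.length ≤ k := (List.prefix_append v [c]).length_le.trans hv
      obtain ⟨d, hd⟩ := automorphism_child hg (u := ⟨v, hv'⟩) (v := ⟨v ++ [c], hv⟩) ⟨c, rfl⟩
      exact (ih hv' hprefix).trans (hd ▸ List.prefix_append _ _)

theorem automorphism_eq_take (hg : g (root m k) = root m k) {u v : Vertex m k}
    (huv : u.1 <+: v.1) : (g u).1 = (g v).1.take u.1.length := by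
  rw [← automorphism_length hg u]
  exact List.prefix_iff_eq_take.1 (automorphism_prefix hg huv)

end Automorphisms

section Orbits

namespace MarkedTuple

variable {m k n : ℕ} {J K : MarkedTuple m k n}

theorem mem_orbit : K ∈ J.orbit ↔ J.Equivalent K := by
  simp [orbit]

theorem Equivalent.sameShape (hJK : J.Equivalent K) : SameShape J.leaves K.leaves := by
  obtain ⟨g, hg, hleaves, -⟩ := hJK
  intro l r s
  let x : Fin n → Vertex m k := fun r => ⟨(J.leaves r).toList.take l,
    (List.length_take_le' l _).trans (List.Vector.toList_length _).le⟩
  have hgx : ∀ r, (g (x r)).1 = (K.leaves r).toList.take l := fun r => by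
    rw [automorphism_eq_take hg (v := (J.leaves r).toVertex) (List.take_prefix l _), hleaves]
    simp [x, Level.toVertex, List.take_eq_take_iff]
  rw [← hgx, ← hgx, Subtype.val_inj, g.injective.eq_iff, Subtype.mk.injEq]

theorem Equivalent.mark_eq_take (hJK : J.Equivalent K) {r : Fin n}
    (hr : J.mark.1 <+: (J.leaves r).toList) :
    K.mark.1 = (K.leaves r).toList.take J.mark.1.length := by
  obtain ⟨g, hg, hleaves, hmark⟩ := hJK
  rw [← hmark, automorphism_eq_take hg (v := (J.leaves r).toVertex) hr, hleaves]
  rfl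

theorem exists_mark_prefix_leaves [NeZero n] (J : MarkedTuple m k n) :
    ∃ r, J.mark.1 <+: (J.leaves r).toList := by
  rcases J.2 with hroot | hleaf
  · exact ⟨0, (congrArg (· <+: (J.leaves 0).toList) hroot).mpr List.nil_prefix⟩
  · exact hleaf

theorem sum_orbit_le {r₀ : Fin n} (hr₀ : J.mark.1 <+: (J.leaves r₀).toList)
    {G : MarkedTuple m k n → ℝ≥0∞} {F : (Fin n → Level m k) → ℝ≥0∞}
    (hGF : ∀ K : MarkedTuple m k n, K.mark.1 = (K.leaves r₀).toList.take J.mark.1.length →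
      G K ≤ F K.leaves) :
    ∑ K ∈ J.orbit, G K ≤ ∑ i ∈ shapeClass J.leaves, F i := by
  classical
  have hmark : ∀ K ∈ J.orbit, K.mark.1 = (K.leaves r₀).toList.take J.mark.1.length :=
    fun K hK => (mem_orbit.1 hK).mark_eq_take hr₀
  have hinj : Set.InjOn leaves (J.orbit : Set (MarkedTuple m k n)) := fun K hK L hL hKL => by
    refine Subtype.ext (Prod.ext hKL (Subtype.ext ?_))
    exact (hmark K hK).trans ((hmark L hL).trans (by rw [hKL])).symm
  calc ∑ K ∈ J.orbit, G K ≤ ∑ K ∈ J.orbit, F K.leaves :=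
        Finset.sum_le_sum fun K hK => hGF K (hmark K hK)
    _ = ∑ i ∈ J.orbit.image leaves, F i := (Finset.sum_image hinj).symm
    _ ≤ ∑ i ∈ shapeClass J.leaves, F i := by
        refine Finset.sum_le_sum_of_subset fun i hi => ?_
        obtain ⟨K, hK, rfl⟩ := Finset.mem_image.1 hi
        exact mem_shapeClass.2 (mem_orbit.1 hK).sameShape

end MarkedTuple

end Orbits

section MarkPower

variable {ι : Type*} [DecidableEq ι] {r₀ : ι} {l₀ : ℕ} {ε : ℝ}

/-- The powers that add to the product of the masses of the words the single factor `mass p ^ ε`,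
where `p` is the vertex at level `l₀` of the branch of index `r₀`. -/
def markPower (r₀ : ι) (l₀ : ℕ) (ε : ℝ) : ι → ℕ → ℝ := fun r l =>
  if r = r₀ ∧ l = l₀ then ε else 0

theorem markPower_nonneg (hε : 0 ≤ ε) (r : ι) (l : ℕ) : 0 ≤ markPower r₀ l₀ ε r l := by
  rw [markPower]
  split_ifs <;> positivity

variable [Fintype ι]

theorem sum_markPower (l : ℕ) : ∑ r, markPower r₀ l₀ ε r l = if l = l₀ then ε else 0 := by
  simp [markPower, ite_and]

theorem degree_markPower {N : ℕ} (hl₀ : l₀ < N) :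
    degree (markPower r₀ l₀ ε) N = Fintype.card ι + ε := by
  rw [degree, Finset.sum_add_distrib, Finset.sum_comm]
  simp [sum_markPower, hl₀]

theorem prod_poweredMass_markPower {m h : ℕ} {Ω : Type*} {w : Word m → Ω → ℝ≥0∞}
    {κ : Word m → ℝ≥0∞} (hl₀ : l₀ ≤ h) (K : ι → Level m h) (ω : Ω) :
    ∏ r, poweredMass w κ (markPower r₀ l₀ ε r) (K r).toList ω =
      (∏ r, mass w κ (K r).toList ω) * mass w κ ((K r₀).toList.take l₀) ω ^ ε := by
  simp only [poweredMass, Finset.prod_mul_distrib]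
  congr 1
  rw [Finset.prod_eq_single r₀ (fun r _ hr => by simp [markPower, hr]) (by simp),
    Finset.prod_eq_single l₀ (fun l _ hl => by simp [markPower, hl])
      (fun hl => absurd (Nat.lt_succ_of_le hl₀) (by simpa using hl))]
  simp [markPower]

theorem prod_rpow_exponent_markPower {m k n : ℕ} (i : Fin n → Level m k) {r₀ : Fin n} {q : ℝ}
    (hl₀ : l₀ ≤ k) (hε : 0 ≤ ε) (hq : 1 < q) (F : ℕ → ℝ≥0∞) :
    ∏ l ∈ Finset.range (k + 1), F l ^ exponent i (markPower r₀ l₀ ε) q l =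
      ((joinLevels i).map fun l => F l ^ (1 / (q - 1))).prod * F l₀ ^ (ε / (q - 1)) := by
  have hq' : 0 < q - 1 := sub_pos.2 hq
  have hmark : F l₀ ^ (ε / (q - 1)) = ∏ l ∈ Finset.range (k + 1),
      F l ^ ((if l = l₀ then ε else 0) / (q - 1)) := by
    rw [Finset.prod_eq_single l₀ (fun l _ hl => by simp [hl])
      (fun hl => absurd (Nat.lt_succ_of_le hl₀) (by simpa using hl)), if_pos rfl]
  rw [prod_joinLevels, hmark, ← Finset.prod_mul_distrib]
  refine Finset.prod_congr rfl fun l _ => ?_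
  rw [← ENNReal.rpow_natCast, ← ENNReal.rpow_mul,
    ← ENNReal.rpow_add_of_nonneg _ _ (by positivity)
      (div_nonneg (by split_ifs <;> positivity) hq'.le),
    exponent, sum_markPower, Nat.cast_sub (vertexCount_le_succ i l)]
  congr 1
  ring

end MarkPower

section Transfer

variable {m : ℕ} {Ω : Type*} {W : Word m → Ω → ℝ} {μ : Measure (ℕ → Fin m)}

theorem mem_cylinder_append_singleton (v : Word m) (c : Fin m) (x : ℕ → Fin m) :
    x ∈ cylinder (v ++ [c]) ↔ x v.length = c ∧ x ∈ cylinder v := by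
  simp only [cylinder, Set.mem_ofPred_eq, List.get_eq_getElem, Fin.forall_iff, List.length_append,
    List.length_singleton]
  constructor
  · intro hx
    refine ⟨by simpa using hx v.length (Nat.lt_succ_self _), fun r hr => ?_⟩
    rw [hx r (Nat.lt_succ_of_lt hr), List.getElem_append_left hr]
  · rintro ⟨hc, hx⟩ r hr
    rcases Nat.lt_succ_iff_lt_or_eq.1 hr with hr' | rfl
    · rw [List.getElem_append_left hr', hx r hr']
    · simpa using hc

/-- The masses that `μ` gives to the cylinders, as the additive mass of a cascade. -/
noncomputable def cylinderMass (μ : Measure (ℕ → Fin m)) (v : Word m) : ℝ≥0∞ := μ (cylinder v)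

theorem cylinderMass_nil [IsProbabilityMeasure μ] : cylinderMass μ [] = 1 := by
  rw [cylinderMass, show cylinder ([] : Word m) = Set.univ from
    Set.eq_univ_of_forall fun x r => r.elim0, measure_univ]

theorem sum_cylinderMass (μ : Measure (ℕ → Fin m)) (v : Word m) :
    ∑ c, cylinderMass μ (v ++ [c]) = cylinderMass μ v := by
  have hletter (c : Fin m) : MeasurableSet ((fun x : ℕ → Fin m => x v.length) ⁻¹' {c}) :=
    measurable_pi_apply v.length (measurableSet_singleton c)
  calc ∑ c, cylinderMass μ (v ++ [c])
      = ∑ c, μ.restrict (cylinder v) ((fun x => x v.length) ⁻¹' {c}) := by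
        refine Finset.sum_congr rfl fun c _ => ?_
        rw [Measure.restrict_apply (hletter c), cylinderMass]
        exact congrArg μ (Set.ext (mem_cylinder_append_singleton v c))
    _ = cylinderMass μ v := by
        rw [sum_measure_preimage_singleton Finset.univ fun c _ => hletter c, Finset.coe_univ,
          Set.preimage_univ, Measure.restrict_apply_univ, cylinderMass]

/-- The weights `W`, with values in `[0, ∞]`. -/
noncomputable def weight (W : Word m → Ω → ℝ) (v : Word m) (ω : Ω) : ℝ≥0∞ := ENNReal.ofReal (W v ω)

theorem Y_nonneg {ω : Ω} (hω : ∀ v, 0 ≤ W v ω) (v : Word m) : 0 ≤ Y W μ v ω :=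
  mul_nonneg (Finset.prod_nonneg fun _ _ => hω _) measureReal_nonneg

theorem ofReal_Y [IsFiniteMeasure μ] {ω : Ω} (hω : ∀ v, 0 ≤ W v ω) (v : Word m) :
    ENNReal.ofReal (Y W μ v ω) = mass (weight W) (cylinderMass μ) v ω := by
  rw [Y, X, ENNReal.ofReal_mul (Finset.prod_nonneg fun _ _ => hω _),
    ENNReal.ofReal_prod_of_nonneg fun _ _ => hω _, ofReal_measureReal]
  rfl

variable [MeasurableSpace Ω] {P : Measure Ω}

theorem isCascade_weight (hW_meas : ∀ v, Measurable (W v)) (hW_indep : iIndepFun W P)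
    (hW_nonneg : ∀ v, 0 ≤ᵐ[P] W v) (hW_mean : ∀ v, ∫ ω, W v ω ∂P = 1) :
    IsCascade P (weight W) (cylinderMass μ) where
  measurable v := (hW_meas v).ennreal_ofReal
  indep := hW_indep.comp (fun _ => ENNReal.ofReal) fun _ => ENNReal.measurable_ofReal
  mean v := by
    have hW_int : Integrable (W v) P :=
      .of_integral_ne_zero ((hW_mean v).trans_ne one_ne_zero)
    simp only [weight]
    rw [← ofReal_integral_eq_lintegral_ofReal hW_int (hW_nonneg v), hW_mean, ENNReal.ofReal_one]
  additive := sum_cylinderMass μ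

theorem levelMoment_eq_moment [IsFiniteMeasure μ] (hW_nonneg : ∀ v, 0 ≤ᵐ[P] W v) {q : ℝ}
    (hq : 0 ≤ q) (l : ℕ) :
    levelMoment P W μ q l = moment P (weight W) (cylinderMass μ) q l := by
  refine Finset.sum_congr rfl fun u _ => lintegral_congr_ae ?_
  filter_upwards [ae_all_iff.2 hW_nonneg] with ω hω
  rw [← ENNReal.ofReal_rpow_of_nonneg (Y_nonneg hω _) hq, ofReal_Y hω]

theorem expect_prod_mul_rpow [IsFiniteMeasure μ] (hW_nonneg : ∀ v, 0 ≤ᵐ[P] W v) {ι γ : Type*}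
    [Fintype ι] (s : Finset γ) (u : ι → Word m) (v : γ → Word m) {ε : ℝ} (hε : 0 ≤ ε) :
    expect P (fun ω => (∏ r, Y W μ (u r) ω) * (∑ j ∈ s, Y W μ (v j) ω) ^ ε) =
      ∫⁻ ω, (∏ r, mass (weight W) (cylinderMass μ) (u r) ω) *
        (∑ j ∈ s, mass (weight W) (cylinderMass μ) (v j) ω) ^ ε ∂P := by
  refine lintegral_congr_ae ?_
  filter_upwards [ae_all_iff.2 hW_nonneg] with ω hω
  have hY : ∀ v, 0 ≤ Y W μ v ω := Y_nonneg hω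
  rw [ENNReal.ofReal_mul (Finset.prod_nonneg fun _ _ => hY _),
    ENNReal.ofReal_prod_of_nonneg fun _ _ => hY _,
    ← ENNReal.ofReal_rpow_of_nonneg (Finset.sum_nonneg fun _ _ => hY _) hε,
    ENNReal.ofReal_sum_of_nonneg fun _ _ => hY _]
  simp only [ofReal_Y hω]

theorem expect_le_patternMoment [IsProbabilityMeasure P] [IsFiniteMeasure μ]
    (hw : IsCascade P (weight W) (cylinderMass μ)) (hW_nonneg : ∀ v, 0 ≤ᵐ[P] W v) {k n l₀ : ℕ}
    (hl₀ : l₀ ≤ k) {ε : ℝ} (hε₀ : 0 ≤ ε) (hε₁ : ε ≤ 1) (K : MarkedTuple m k n) {r₀ : Fin n}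
    (hK : K.mark.1 = (K.leaves r₀).toList.take l₀) :
    expect P (fun ω => (∏ r, Y W μ (K.leaves r).toList ω) *
        (∑ j : Level m k with meetTree j.toList K.leaves = K.mark.1, Y W μ j.toList ω) ^ ε) ≤
      patternMoment P (weight W) (cylinderMass μ) (markPower r₀ l₀ ε) K.leaves := by
  rw [expect_prod_mul_rpow hW_nonneg _ _ _ hε₀]
  refine (hw.lintegral_sum_mass_meetTree_le K.2 hε₀ hε₁).trans_eq ?_
  simp only [patternMoment, prod_poweredMass_markPower hl₀, ← hK]
  rfl

end Transfer

end Cascade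


theorem proposition3p1_general {Ω : Type*} [MeasurableSpace Ω] (P : Measure Ω)
    [IsProbabilityMeasure P] (m k : ℕ)
    (W : Cascade.Word m → Ω → ℝ) (hW_meas : ∀ v, Measurable (W v)) (hW_indep : iIndepFun W P)
    (hW_nonneg : ∀ v, 0 ≤ᵐ[P] W v) (hW_mean : ∀ v, ∫ ω, W v ω ∂P = 1)
    (μ : Measure (ℕ → Fin m)) [IsProbabilityMeasure μ]
    (n : ℕ) (ε q : ℝ) (hn : n ≠ 0) (hε₀ : 0 ≤ ε) (hε₁ : ε ≤ 1) (hq : n + ε ≤ q) (hq₁ : 1 < q)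
    (J : Cascade.MarkedTuple m k n) :
    Multiset.card (Cascade.joinLevels J.leaves) + 1 = n ∧
    ∑ K ∈ J.orbit, Cascade.expect P (fun ω =>
        (∏ r, Cascade.Y W μ (K.leaves r).toList ω) *
          (∑ j : Cascade.Level m k with Cascade.meetTree j.toList K.leaves = K.mark.1,
            Cascade.Y W μ j.toList ω) ^ ε) ≤
      ((Cascade.joinLevels J.leaves).map fun l =>
          Cascade.levelMoment P W μ q l ^ (1 / (q - 1))).prod *
        Cascade.levelMoment P W μ q J.mark.1.length ^ (ε / (q - 1)) := by
  have : NeZero n := ⟨hn⟩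
  refine ⟨Cascade.card_joinLevels J.leaves, ?_⟩
  have hw : Cascade.IsCascade P (Cascade.weight W) (Cascade.cylinderMass μ) :=
    Cascade.isCascade_weight hW_meas hW_indep hW_nonneg hW_mean
  obtain ⟨r₀, hr₀⟩ := J.exists_mark_prefix_leaves
  have hl₀ : J.mark.1.length ≤ k := J.mark.2
  let α := Cascade.markPower r₀ J.mark.1.length ε
  have hdeg : Cascade.degree α (k + 1) ≤ q := by
    rwa [Cascade.degree_markPower (Nat.lt_succ_of_le hl₀), Fintype.card_fin]
  calc _ ≤ ∑ i ∈ Cascade.shapeClass J.leaves,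
        Cascade.patternMoment P (Cascade.weight W) (Cascade.cylinderMass μ) α i :=
        Cascade.MarkedTuple.sum_orbit_le hr₀ fun K hK =>
          Cascade.expect_le_patternMoment hw hW_nonneg hl₀ hε₀ hε₁ K hK
    _ ≤ Cascade.momentBound P (Cascade.weight W) (Cascade.cylinderMass μ) q
          (Cascade.exponent J.leaves α q) (k + 1) :=
        hw.sum_patternMoment_le hq₁ J.leaves (Cascade.markPower_nonneg hε₀) hdeg
    _ = _ := by
        rw [Cascade.momentBound, Cascade.cylinderMass_nil, ENNReal.one_rpow, one_mul,
          Cascade.prod_rpow_exponent_markPower J.leaves hl₀ hε₀ hq₁]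
        simp only [Cascade.levelMoment_eq_moment hW_nonneg (zero_le_one.trans hq₁.le)]

theorem proposition3p1 {Ω : Type*} [MeasurableSpace Ω] (P : Measure Ω) [IsProbabilityMeasure P]
    (m k : ℕ) (hm : 2 ≤ m) (hk : 1 ≤ k)
    (W : Cascade.Word m → Ω → ℝ) (hW_meas : ∀ v, Measurable (W v)) (hW_indep : iIndepFun W P)
    (hW_pos : ∀ v, ∀ᵐ ω ∂P, 0 < W v ω) (hW_mean : ∀ v, ∫ ω, W v ω ∂P = 1)
    (μ : Measure (ℕ → Fin m)) [IsProbabilityMeasure μ]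
    (n : ℕ) (ε q : ℝ) (hε₀ : 0 ≤ ε) (hε₁ : ε < 1) (hq : q = n + ε) (hq₁ : 1 < q)
    (J : Cascade.MarkedTuple m k n) :
    Multiset.card (Cascade.joinLevels J.leaves) + 1 = n ∧
    ∑ K ∈ J.orbit, Cascade.expect P (fun ω =>
        (∏ r, Cascade.Y W μ (K.leaves r).toList ω) *
          (∑ j : Cascade.Level m k with Cascade.meetTree j.toList K.leaves = K.mark.1,
            Cascade.Y W μ j.toList ω) ^ ε) ≤
      ((Cascade.joinLevels J.leaves).map fun l =>
          Cascade.levelMoment P W μ q l ^ (1 / (q - 1))).prod *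
        Cascade.levelMoment P W μ q J.mark.1.length ^ (ε / (q - 1)) := by
  have hn : n ≠ 0 := fun hn => by rw [hn, Nat.cast_zero] at hq; linarith
  exact proposition3p1_general P m k W hW_meas hW_indep (fun v => (hW_pos v).mono fun _ => le_of_lt)
    hW_mean μ n ε q hn hε₀ hε₁.le hq.ge hq₁ J
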